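/- **Setting.** On $T^*\mathbb R^2$ with coordinates $(q_3,q_4,p_3,p_4)$ and symplectic form $\omega=\sum_{i=3}^4 dp_i\wedge dq_i$, the circular double Sitnikov problem (in the limit of vanishing secondary masses) is the Hamiltonian system $$H=\tfrac12(p_3^2+p_4^2)-\frac1{\sqrt{q_3^2+1/4}}-\frac1{\sqrt{q_4^2+1/4}},\qquad i_{X_H}\omega=s\,dH ,$$ where the sign convention is $s=1$ ($\dot q=-\partial H/\partial p$, $\dot p=\partial H/\partial q$) or $s=-1$ ($\dot q=\partial H/\partial p$, $\dot p=-\partial H/\partial q$). Let $h_i=\tfrac12p_i^2-(q_i^2+1/4)^{-1/2}$ be the partial energies, $U=\{-2<h_3<0,\ -2<h_4<0\}$, and let $$K(k)=\int_0^{\pi/2}\!\frac{d\varphi}{\sqrt{1-k^2\sin^2\varphi}},\quad E(k)=\int_0^{\pi/2}\!\sqrt{1-k^2\sin^2\varphi}\,d\varphi,\quad \Pi(n,k)=\int_0^{\pi/2}\!\frac{d\varphi}{(1-n\sin^2\varphi)\sqrt{1-k^2\sin^2\varphi}} .$$ For $h\in(-2,0)$ put $k=\frac{\sqrt{2+h}}2$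 and $$J(h)=\frac{\sqrt2}{\pi}\bigl(2E(k)-K(k)-\Pi(2k^2,k)\bigr),\qquad \Omega(h)=\frac{\sqrt2}{4\pi(1-2k^2)}\bigl(2E(k)-K(k)+\Pi(2k^2,k)\bigr).$$ **Theorem.** Let $s\in\{1,-1\}$. 1. For every solution defined for all times and each $i$ with $h_i\in(-2,0)$, the motion $t\mapsto(q_i(t),p_i(t))$ is periodic with minimal period $2\pi\Omega(h_i)$, and its action is $$\frac1{2\pi}\int_0^{2\pi\Omega(h_i)}p_i(t)\,\dot q_i(t)\,dt=s\,J(h_i).$$ 2. There are action-angle coordinates $(\theta_3,\theta_4,J_3,J_4)$ on $U$ whose actions are $J_i=s\,J(h_i)$. Precisely, with $D=\{(J_3,J_4): J_i\in s\,J((-2,0))\}$, which is open, there is a smooth map $\Psi:(\theta,J)\mapsto(q,p)$ on $\mathbb R^2\times D$ with image $U$ such that: $\Psi(\theta,J)=\Psi(\theta',J')$ if and only if $J=J'$ and $\theta-\theta'\in(2\pi\mathbb Z)^2$; $\Psi^*\sum dp_i\wedge dq_i=\sum dJ_i\wedge d\theta_i$; $H\circ\Psi$ depends only on $J$; $J_i=\frac1{2\pi}\oint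 p\,dq$ over the cycle on which $\theta_i$ runs from $0$ to $2\pi$; and $J_i=s\,J(h_i(\Psi(\theta,J)))$. 3. In these coordinates the angles are linear in time: for every solution starting in $U$ there are constants $\theta_{0,i}$ such that the solution is, for all $t\in\mathbb R$, the curve $$\theta_i(t)=\frac1{\Omega(h_i)}\,t+\theta_{0,i},\qquad J_i(t)=s\,J(h_i);$$ conversely, for all $\theta_{0,i}\in\mathbb R$ and $h_i\in(-2,0)$ this curve is a solution. -/

import Mathlib

open Set
open scoped ContDiff

namespace DoubleSitnikov

noncomputable section

/-! ### Complete elliptic integrals in Legendre form, with modulus `k` and characteristic `n` -/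

/-- Complete elliptic integral of the first kind `K(k)`. -/
def ellipticK (k : ℝ) : ℝ :=
  ∫ φ in (0 : ℝ)..(Real.pi / 2), 1 / Real.sqrt (1 - k ^ 2 * Real.sin φ ^ 2)

/-- Complete elliptic integral of the second kind `E(k)`. -/
def ellipticE (k : ℝ) : ℝ :=
  ∫ φ in (0 : ℝ)..(Real.pi / 2), Real.sqrt (1 - k ^ 2 * Real.sin φ ^ 2)

/-- Complete elliptic integral of the third kind `Π(n, k)`. -/
def ellipticPi (n k : ℝ) : ℝ :=
  ∫ φ in (0 : ℝ)..(Real.pi / 2),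
    1 / ((1 - n * Real.sin φ ^ 2) * Real.sqrt (1 - k ^ 2 * Real.sin φ ^ 2))

/-! ### Hamiltonian systems on `T*ℝ²` -/

/-- The phase space `T*ℝ²`: a point is `(q, p)`, so `x.1` is the position and `x.2` the momentum.
The indices `0, 1` are the two secondaries. -/
abbrev Phase : Type := (Fin 2 → ℝ) × (Fin 2 → ℝ)

/-- The symplectic form `ω = ∑ dpᵢ ∧ dqᵢ`. For pairs `(θ, J)` it is `∑ dJᵢ ∧ dθᵢ`. -/
def omega (v w : Phase) : ℝ := ∑ i, (v.2 i * w.1 i - w.2 i * v.1 i)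

/-- `x` is an integral curve, for all times, of the Hamiltonian vector field `X` defined by
`i_X ω = s dH`, that is `ω(X, w) = s dH(w)` for all `w`. The sign `s = 1` or `s = -1` is the
sign convention: `s = 1` gives `q' = -∂H/∂p`, `p' = ∂H/∂q`, and
`s = -1` gives `q' = ∂H/∂p`, `p' = -∂H/∂q`. -/
def IsHamiltonianCurve (s : ℝ) (H : Phase → ℝ) (x : ℝ → Phase) : Prop :=
  ∀ t, ∃ v : Phase, HasDerivAt x v t ∧ ∀ w : Phase, omega v w = s * fderiv ℝ H (x t) w

/-- Action-angle coordinates for `H` on `U`, with actions in `D`, given by the map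
`Ψ : (θ, J) ↦ (q, p)`, where the angles `θ` are taken modulo `2π`. -/
structure IsActionAngleChart (H : Phase → ℝ) (U : Set Phase) (D : Set (Fin 2 → ℝ))
    (Ψ : Phase → Phase) : Prop where
  isOpen_actions : IsOpen D
  smooth : ContDiffOn ℝ ∞ Ψ (univ ×ˢ D)
  image_eq : Ψ '' (univ ×ˢ D) = U
  eq_iff : ∀ z ∈ (univ : Set (Fin 2 → ℝ)) ×ˢ D, ∀ w ∈ (univ : Set (Fin 2 → ℝ)) ×ˢ D,
    (Ψ z = Ψ w ↔ z.2 = w.2 ∧ ∀ i, ∃ n : ℤ, z.1 i = w.1 i + 2 * Real.pi * n)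
  /-- the coordinates are canonical: `∑ dpᵢ ∧ dqᵢ = ∑ dJᵢ ∧ dθᵢ` -/
  symplectic : ∀ z ∈ (univ : Set (Fin 2 → ℝ)) ×ˢ D, ∀ v w : Phase,
    omega (fderiv ℝ Ψ z v) (fderiv ℝ Ψ z w) = omega v w
  /-- the energy is a function of the actions alone -/
  energy : ∀ z ∈ (univ : Set (Fin 2 → ℝ)) ×ˢ D, ∀ w ∈ (univ : Set (Fin 2 → ℝ)) ×ˢ D,
    z.2 = w.2 → H (Ψ z) = H (Ψ w)
  /-- `Jᵢ = (1 / 2π) ∮ p dq` over the cycle on which `θᵢ` runs from `0` to `2π` -/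
  action_eq : ∀ z ∈ (univ : Set (Fin 2 → ℝ)) ×ˢ D, ∀ i,
    z.2 i = 1 / (2 * Real.pi) * ∫ φ in (0 : ℝ)..(2 * Real.pi),
      ∑ j, (Ψ (Function.update z.1 i φ, z.2)).2 j *
        deriv (fun ψ : ℝ => (Ψ (Function.update z.1 i ψ, z.2)).1 j) φ

/-! ### The circular double Sitnikov problem -/

/-- The partial energy `hᵢ = pᵢ² / 2 - 1 / √(qᵢ² + 1/4)` of one secondary. -/
def partialEnergy (x : Phase) (i : Fin 2) : ℝ :=
  x.2 i ^ 2 / 2 - 1 / Real.sqrt (x.1 i ^ 2 + 1 / 4)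

/-- `H = |p|² / 2 - 1 / √(q₃² + 1/4) - 1 / √(q₄² + 1/4)`. -/
def hamiltonian (x : Phase) : ℝ :=
  1 / 2 * (x.2 0 ^ 2 + x.2 1 ^ 2) - 1 / Real.sqrt (x.1 0 ^ 2 + 1 / 4)
    - 1 / Real.sqrt (x.1 1 ^ 2 + 1 / 4)

/-- The region in which both secondaries oscillate. -/
def oscillationRegion : Set Phase := {x | ∀ i, partialEnergy x i ∈ Ioo (-2 : ℝ) 0}

/-- The modulus `k = √(2 + h) / 2`. -/
def modulus (h : ℝ) : ℝ := Real.sqrt (2 + h) / 2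

/-- `J(h) = (√2 / π) (2 E(k) - K(k) - Π(2k², k))`. -/
def actionJ (h : ℝ) : ℝ :=
  Real.sqrt 2 / Real.pi * (2 * ellipticE (modulus h) - ellipticK (modulus h)
    - ellipticPi (2 * modulus h ^ 2) (modulus h))

/-- `Ω(h) = √2 / (4π (1 - 2k²)) (2 E(k) - K(k) + Π(2k², k))`. -/
def returnOmega (h : ℝ) : ℝ :=
  Real.sqrt 2 / (4 * Real.pi * (1 - 2 * modulus h ^ 2)) *
    (2 * ellipticE (modulus h) - ellipticK (modulus h)
      + ellipticPi (2 * modulus h ^ 2) (modulus h))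

end

end DoubleSitnikov

/-! The two secondaries do not interact, so everything reduces to one degree of freedom
(`isHamiltonianCurve_iff`). The substitution q = X √(1 - X²) / (1 - 2X²) turns the potential into
4X² - 2; with p = -2√2 s Y the partial energy is 4(X² + Y²) - 2 (`energyOne_positionProfile`). The
level sets in U thus become circles X = √m sin φ, Y = √m cos φ with m = k² = (h + 2)/4, and the flow
traverses them with dt/dφ = `timeDensity` (`hasDerivAt_orbit`).

Time along the circle, divided by its mean rate `meanTime`, is the angle; `s * areaAction` is (1/2π)
∮ p dq. Two computations carry the proof. The derivative of `areaAction` in m is -4 `meanTime`,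
which is dJ/dh = -Ω, because the m-derivative of its integrand is 4 `timeDensity` up to a
φ-derivative (`hasDerivAt_areaAction`). And one explicit antiderivative reduces the period integral
to Legendre's E, K and Π (`legendre_reduction`), identifying `meanTime` with Ω and `areaAction` with
J.

The map (φ, m) ↦ (angle, action) is injective with triangular invertible derivative, so its inverse
is smooth (`smooth_invFunOn`); composed with the orbit it gives `chartOne`. There ∂/∂θ is Ω times
the Hamiltonian field, and dJ/dh = -Ω makes the chart canonical (`chartOne_symplectic`). Lines of
slope 1/Ω are solutions, and uniqueness for the globally Lipschitz field shows that there are no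
others (`solution_eq_chartOne`). The product of two such charts is the required one. -/

namespace DoubleSitnikov

open Filter Topology MeasureTheory

/-! ### Smooth dependence of integrals on parameters -/

section ParametricIntegrals

variable {H E : Type} [NormedAddCommGroup H] [NormedSpace ℝ H] [FiniteDimensional ℝ H]
  [NormedAddCommGroup E] [NormedSpace ℝ E]

/-- Differentiation under the integral sign for a smooth integrand on a compact interval. -/
theorem hasFDerivAt_intervalIntegral_of_contDiffOn {U : Set H} (hU : IsOpen U) {F : H × ℝ → E}
    (hF : ContDiffOn ℝ ∞ F (U ×ˢ univ)) (a b : ℝ) {x : H} (hx : x ∈ U) :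
    HasFDerivAt (fun y => ∫ t in a..b, F (y, t))
      (∫ t in a..b, (fderiv ℝ F (x, t)).comp (ContinuousLinearMap.inl ℝ H ℝ)) x := by
  have hO : IsOpen (U ×ˢ (univ : Set ℝ)) := hU.prod isOpen_univ
  have hF' : ContinuousOn (fun z : H × ℝ =>
      (fderiv ℝ F z).comp (ContinuousLinearMap.inl ℝ H ℝ)) (U ×ˢ univ) :=
    (hF.continuousOn_fderiv_of_isOpen hO (by simp)).clm_comp continuousOn_const
  have hpr : ProperSpace H := FiniteDimensional.proper ℝ H
  obtain ⟨r, hr, hrU⟩ := Metric.nhds_basis_closedBall.mem_iff.1 (hU.mem_nhds hx)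
  obtain ⟨C, hC⟩ := ((isCompact_closedBall x r).prod (isCompact_uIcc (a := a) (b := b)))
    |>.exists_bound_of_continuousOn (hF'.mono (prod_mono hrU (subset_univ _)))
  have hcont : ∀ y ∈ U, Continuous fun t : ℝ => F (y, t) := fun y hy =>
    hF.continuousOn.comp_continuous (by fun_prop) fun t => ⟨hy, mem_univ _⟩
  refine intervalIntegral.hasFDerivAt_integral_of_dominated_of_fderiv_le (bound := fun _ => C)
    (F' := fun y t => (fderiv ℝ F (y, t)).comp (ContinuousLinearMap.inl ℝ H ℝ))
    (Metric.closedBall_mem_nhds x hr) ?_ ((hcont x hx).intervalIntegrable _ _) ?_ ?_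
    intervalIntegrable_const ?_
  · filter_upwards [hU.mem_nhds hx] with y hy
    exact (hcont y hy).aestronglyMeasurable
  · exact (hF'.comp_continuous (f := fun t : ℝ => (x, t)) (by fun_prop)
      fun t => ⟨hx, mem_univ _⟩).aestronglyMeasurable
  · exact Eventually.of_forall fun t ht y hy => hC (y, t) ⟨hy, uIoc_subset_uIcc ht⟩
  · refine Eventually.of_forall fun t _ y hy => ?_
    have h1 : HasFDerivAt F (fderiv ℝ F (y, t)) (y, t) :=
      ((hF.contDiffAt (hO.mem_nhds ⟨hrU hy, mem_univ _⟩)).differentiableAt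
        (by simp)).hasFDerivAt
    exact h1.comp y (hasFDerivAt_prodMk_left y t)

/-- Induction on the order of differentiability: the derivative is again an integral of a smooth
integrand, but with values in a space of linear maps, so the target space has to vary in the
induction. -/
theorem contDiffOn_intervalIntegral {U : Set H} (hU : IsOpen U) {F : H × ℝ → E}
    (hF : ContDiffOn ℝ ∞ F (U ×ˢ univ)) (a b : ℝ) :
    ContDiffOn ℝ ∞ (fun y => ∫ t in a..b, F (y, t)) U := by
  refine contDiffOn_infty.2 fun n => ?_
  induction n generalizing E with
  | zero =>
    exact contDiffOn_zero.2 fun x hx =>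
      (hasFDerivAt_intervalIntegral_of_contDiffOn hU hF a b hx).continuousAt.continuousWithinAt
  | succ n ih =>
    rw [Nat.cast_succ, contDiffOn_succ_iff_fderiv_of_isOpen hU]
    refine ⟨fun x hx =>
      (hasFDerivAt_intervalIntegral_of_contDiffOn hU hF a b hx).differentiableAt
        |>.differentiableWithinAt, by simp, ?_⟩
    have hF' : ContDiffOn ℝ ∞ (fun z : H × ℝ =>
        (fderiv ℝ F z).comp (ContinuousLinearMap.inl ℝ H ℝ)) (U ×ˢ univ) :=
      (hF.fderiv_of_isOpen (hU.prod isOpen_univ) (by simp)).clm_comp contDiffOn_const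
    exact (ih hF').congr fun x hx =>
      (hasFDerivAt_intervalIntegral_of_contDiffOn hU hF a b hx).fderiv

/-- Rescaling the integration variable to [0, 1] moves the variable endpoint into the integrand. -/
theorem contDiffOn_intervalIntegral_upper {S : Set ℝ} (hS : IsOpen S) {f : ℝ × ℝ → ℝ}
    (hf : ContDiffOn ℝ ∞ f (univ ×ˢ S)) :
    ContDiffOn ℝ ∞ (fun z : ℝ × ℝ => ∫ u in (0 : ℝ)..z.1, f (u, z.2)) (univ ×ˢ S) := by
  have h : ContDiffOn ℝ ∞ (fun y : (ℝ × ℝ) × ℝ => f (y.1.1 * y.2, y.1.2))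
      ((univ ×ˢ S) ×ˢ univ) :=
    hf.comp (by fun_prop) fun y hy => ⟨mem_univ _, hy.1.2⟩
  refine (contDiffOn_fst.mul
    (contDiffOn_intervalIntegral (isOpen_univ.prod hS) h 0 1)).congr fun z _ => ?_
  simpa using (intervalIntegral.mul_integral_comp_mul_left (a := 0) (b := 1)
    (f := fun u => f (u, z.2)) z.1).symm

theorem hasDerivAt_intervalIntegral_of_contDiffOn {S : Set ℝ} (hS : IsOpen S) {f : ℝ → ℝ → ℝ}
    {f' : ℝ → ℝ}
    (hf : ContDiffOn ℝ ∞ (fun z : ℝ × ℝ => f z.1 z.2) (univ ×ˢ S)) {m : ℝ} (hm : m ∈ S)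
    (hf' : ∀ φ, HasDerivAt (f φ) (f' φ) m) (a b : ℝ) :
    HasDerivAt (fun m => ∫ φ in a..b, f φ m) (∫ φ in a..b, f' φ) m := by
  have hF : ContDiffOn ℝ ∞ (fun z : ℝ × ℝ => f z.2 z.1) (S ×ˢ univ) :=
    hf.comp (f := fun z : ℝ × ℝ => (z.2, z.1)) (by fun_prop) fun z hz => ⟨mem_univ _, hz.1⟩
  have hO : IsOpen (S ×ˢ (univ : Set ℝ)) := hS.prod isOpen_univ
  have hc : Continuous fun φ : ℝ => (fderiv ℝ (fun z : ℝ × ℝ => f z.2 z.1) (m, φ)).comp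
      (ContinuousLinearMap.inl ℝ ℝ ℝ) :=
    ((hF.continuousOn_fderiv_of_isOpen hO (by simp)).clm_comp
      continuousOn_const).comp_continuous (f := fun φ : ℝ => (m, φ)) (by fun_prop)
        fun φ => ⟨hm, mem_univ _⟩
  have h := (hasFDerivAt_intervalIntegral_of_contDiffOn hS hF a b hm).hasDerivAt
  rw [ContinuousLinearMap.intervalIntegral_apply
    (φ := fun t => (fderiv ℝ (fun z : ℝ × ℝ => f z.2 z.1) (m, t)).comp
      (ContinuousLinearMap.inl ℝ ℝ ℝ)) (hc.intervalIntegrable a b)] at h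
  refine h.congr_deriv (intervalIntegral.integral_congr fun φ _ => Eq.symm ?_)
  have h1 : HasFDerivAt (fun z : ℝ × ℝ => f z.2 z.1)
      (fderiv ℝ (fun z : ℝ × ℝ => f z.2 z.1) (m, φ)) (m, φ) :=
    ((hF.contDiffAt (hO.mem_nhds ⟨hm, mem_univ _⟩)).differentiableAt (by simp)).hasFDerivAt
  exact (hf' φ).unique (HasFDerivAt.comp (g := fun z : ℝ × ℝ => f z.2 z.1)
    (f := fun m : ℝ => (m, φ)) m h1 (hasFDerivAt_prodMk_left m φ)).hasDerivAt

end ParametricIntegrals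

/-! ### Parametrization of the level sets of the partial energy -/

noncomputable section

theorem one_sub_two_mul_sin_sq_pos {m : ℝ} (hm : m ∈ Ioo (0 : ℝ) (1 / 2)) (φ : ℝ) :
    0 < 1 - 2 * m * Real.sin φ ^ 2 := by
  nlinarith [Real.sin_sq_le_one φ, hm.1, hm.2, sq_nonneg (Real.sin φ)]

theorem one_sub_mul_sin_sq_pos {m : ℝ} (hm : m ∈ Ioo (0 : ℝ) (1 / 2)) (φ : ℝ) :
    0 < 1 - m * Real.sin φ ^ 2 := by
  nlinarith [Real.sin_sq_le_one φ, hm.1, hm.2, sq_nonneg (Real.sin φ)]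

/-- The derivative of time with respect to the parameter `φ` on the level set of energy
`4 m - 2`. -/
def timeDensity (φ m : ℝ) : ℝ :=
  Real.sqrt 2 / 4 / ((1 - 2 * m * Real.sin φ ^ 2) ^ 2 * Real.sqrt (1 - m * Real.sin φ ^ 2))

theorem timeDensity_pos {m : ℝ} (hm : m ∈ Ioo (0 : ℝ) (1 / 2)) (φ : ℝ) :
    0 < timeDensity φ m := by
  have := one_sub_two_mul_sin_sq_pos hm φ
  have := one_sub_mul_sin_sq_pos hm φ
  unfold timeDensity
  positivity

theorem contDiffOn_timeDensity :
    ContDiffOn ℝ ∞ (fun z : ℝ × ℝ => timeDensity z.1 z.2) (univ ×ˢ Ioo 0 (1 / 2)) := by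
  unfold timeDensity
  refine contDiffOn_const.div (ContDiffOn.mul (by fun_prop)
    (ContDiffOn.sqrt (by fun_prop) ?_)) ?_
  · exact fun z hz => (one_sub_mul_sin_sq_pos hz.2 _).ne'
  · intro z hz
    have := one_sub_two_mul_sin_sq_pos hz.2 z.1
    have := one_sub_mul_sin_sq_pos hz.2 z.1
    positivity

theorem continuous_timeDensity {m : ℝ} (hm : m ∈ Ioo (0 : ℝ) (1 / 2)) :
    Continuous fun φ => timeDensity φ m :=
  contDiffOn_timeDensity.continuousOn.comp_continuous (f := fun φ : ℝ => (φ, m)) (by fun_prop)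
    fun _ => ⟨mem_univ _, hm⟩

/-- The time needed to go from the parameter `0` to the parameter `φ`. -/
def timeFunction (φ m : ℝ) : ℝ := ∫ u in (0 : ℝ)..φ, timeDensity u m

/-- The period divided by `2π`. -/
def meanTime (m : ℝ) : ℝ := timeFunction (2 * Real.pi) m / (2 * Real.pi)

/-- Minus the area enclosed by the level set, divided by `2π`. -/
def areaAction (m : ℝ) : ℝ :=
  -(∫ φ in (0 : ℝ)..(2 * Real.pi), 8 * m * Real.cos φ ^ 2 * timeDensity φ m) / (2 * Real.pi)

theorem contDiffOn_timeFunction :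
    ContDiffOn ℝ ∞ (fun z : ℝ × ℝ => timeFunction z.1 z.2) (univ ×ˢ Ioo 0 (1 / 2)) :=
  contDiffOn_intervalIntegral_upper isOpen_Ioo contDiffOn_timeDensity

theorem hasDerivAt_timeFunction {m : ℝ} (hm : m ∈ Ioo (0 : ℝ) (1 / 2)) (φ : ℝ) :
    HasDerivAt (fun φ => timeFunction φ m) (timeDensity φ m) φ :=
  intervalIntegral.integral_hasDerivAt_right ((continuous_timeDensity hm).intervalIntegrable _ _)
    ((continuous_timeDensity hm).stronglyMeasurableAtFilter _ _)
    (continuous_timeDensity hm).continuousAt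

theorem strictMono_timeFunction {m : ℝ} (hm : m ∈ Ioo (0 : ℝ) (1 / 2)) :
    StrictMono fun φ => timeFunction φ m :=
  strictMono_of_hasDerivAt_pos (hasDerivAt_timeFunction hm) (timeDensity_pos hm)

@[simp]
theorem timeFunction_zero (m : ℝ) : timeFunction 0 m = 0 := by simp [timeFunction]

theorem meanTime_pos {m : ℝ} (hm : m ∈ Ioo (0 : ℝ) (1 / 2)) : 0 < meanTime m := by
  have := strictMono_timeFunction hm Real.two_pi_pos
  simp only [timeFunction_zero] at this
  exact div_pos this Real.two_pi_pos

theorem timeFunction_add_two_pi {m : ℝ} (hm : m ∈ Ioo (0 : ℝ) (1 / 2)) (φ : ℝ) :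
    timeFunction (φ + 2 * Real.pi) m = timeFunction φ m + 2 * Real.pi * meanTime m := by
  have hp : Function.Periodic (fun φ => timeDensity φ m) (2 * Real.pi) := fun φ => by
    simp [timeDensity]
  have h := hp.intervalIntegral_add_eq 0 φ
  have hi := fun a b => (continuous_timeDensity hm).intervalIntegrable (μ := volume) a b
  have h2 := intervalIntegral.integral_add_adjacent_intervals (hi 0 φ) (hi φ (φ + 2 * Real.pi))
  rw [← h, zero_add] at h2
  unfold meanTime timeFunction
  rw [← h2]
  field_simp

theorem timeFunction_add_int_mul_two_pi {m : ℝ} (hm : m ∈ Ioo (0 : ℝ) (1 / 2)) (φ : ℝ) (n : ℤ) :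
    timeFunction (φ + 2 * Real.pi * n) m
      = timeFunction φ m + 2 * Real.pi * n * meanTime m := by
  -- Removing the linear growth leaves a periodic function, for which all integer multiples of the
  -- period are available at once.
  have h : Function.Periodic
      (fun φ => timeFunction φ m - φ * meanTime m) (2 * Real.pi) := fun φ => by
    simp only [timeFunction_add_two_pi hm]; ring
  have := h.int_mul n φ
  simp only [mul_comm (n : ℝ)] at this
  linarith

/-- The values at 2πn are n times the period, hence unbounded in both directions; the intermediate
value theorem does the rest. -/
theorem surjective_timeFunction {m : ℝ} (hm : m ∈ Ioo (0 : ℝ) (1 / 2)) :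
    Function.Surjective fun φ => timeFunction φ m := by
  intro y
  have hΩ := mul_pos Real.two_pi_pos (meanTime_pos hm)
  have hn : ∀ n : ℤ, timeFunction (2 * Real.pi * n) m = n * (2 * Real.pi * meanTime m) := by
    intro n
    have := timeFunction_add_int_mul_two_pi hm 0 n
    rw [zero_add, timeFunction_zero] at this
    rw [this]; ring
  refine mem_range_of_exists_le_of_exists_ge
    (continuous_iff_continuousAt.2 fun φ => (hasDerivAt_timeFunction hm φ).continuousAt) ?_ ?_
  · refine ⟨2 * Real.pi * ⌊y / (2 * Real.pi * meanTime m)⌋, ?_⟩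
    rw [hn, ← le_div_iff₀ hΩ]
    exact Int.floor_le _
  · refine ⟨2 * Real.pi * ⌈y / (2 * Real.pi * meanTime m)⌉, ?_⟩
    rw [hn, ← div_le_iff₀ hΩ]
    exact Int.le_ceil _

/-! ### Derivative of the enclosed area with respect to m -/

/-- The time density as a function of `x = m sin² φ`. -/
def densityProfile (x : ℝ) : ℝ := Real.sqrt 2 / 4 / ((1 - 2 * x) ^ 2 * Real.sqrt (1 - x))

theorem timeDensity_eq (φ m : ℝ) : timeDensity φ m = densityProfile (m * Real.sin φ ^ 2) := by
  simp only [timeDensity, densityProfile, mul_assoc]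

theorem hasDerivAt_densityProfile {x : ℝ} (hx : 0 < 1 - 2 * x) (hx' : 0 < 1 - x) :
    HasDerivAt densityProfile
      (densityProfile x * (4 / (1 - 2 * x) + 1 / (2 * (1 - x)))) x := by
  have h1 : HasDerivAt (fun x : ℝ => 1 - 2 * x) (-2) x := by
    simpa using ((hasDerivAt_id x).const_mul 2).const_sub 1
  have h2 : HasDerivAt (fun x : ℝ => Real.sqrt (1 - x)) (-1 / (2 * Real.sqrt (1 - x))) x :=
    ((hasDerivAt_id x).const_sub 1).sqrt hx'.ne'
  have hs : 0 < Real.sqrt (1 - x) := Real.sqrt_pos.2 hx'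
  have h3 := (hasDerivAt_const x (Real.sqrt 2 / 4)).div ((h1.pow 2).mul h2)
    (mul_ne_zero (pow_ne_zero 2 hx.ne') hs.ne')
  refine h3.congr_deriv ?_
  have hq : 1 - x = Real.sqrt (1 - x) ^ 2 := (Real.sq_sqrt hx'.le).symm
  simp only [densityProfile, Pi.mul_apply, Pi.pow_apply]
  rw [show (1 : ℝ) / (2 * (1 - x)) = 1 / (2 * Real.sqrt (1 - x) ^ 2) by rw [← hq]]
  field_simp
  ring

/-- The density depends on φ and m only through m sin² φ, so in both derivatives the derivative of
the profile appears with the same factor 8m sin² φ cos² φ and cancels. What remains is 8cos² φ = 4 +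
4(cos² φ - sin² φ). -/
theorem hasDerivAt_areaIntegrand {m : ℝ} (hm : m ∈ Ioo (0 : ℝ) (1 / 2)) (φ : ℝ) :
    ∃ d, HasDerivAt (fun m => 8 * m * Real.cos φ ^ 2 * timeDensity φ m)
        (4 * timeDensity φ m + d) m ∧
      HasDerivAt (fun φ => 4 * Real.sin φ * Real.cos φ * timeDensity φ m) d φ := by
  have hg := hasDerivAt_densityProfile (x := m * Real.sin φ ^ 2)
    (by linarith [one_sub_two_mul_sin_sq_pos hm φ]) (one_sub_mul_sin_sq_pos hm φ)
  set g' := densityProfile (m * Real.sin φ ^ 2) *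
    (4 / (1 - 2 * (m * Real.sin φ ^ 2)) + 1 / (2 * (1 - m * Real.sin φ ^ 2)))
  simp only [timeDensity_eq]
  have h1 : HasDerivAt (fun m => densityProfile (m * Real.sin φ ^ 2)) (g' * Real.sin φ ^ 2) m :=
    HasDerivAt.comp (h₂ := densityProfile) m hg
      (by simpa using (hasDerivAt_id m).mul_const (Real.sin φ ^ 2))
  have h2 : HasDerivAt (fun φ => densityProfile (m * Real.sin φ ^ 2))
      (g' * (2 * m * Real.sin φ * Real.cos φ)) φ :=
    HasDerivAt.comp (h₂ := densityProfile) φ hg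
      ((((Real.hasDerivAt_sin φ).pow 2).const_mul m).congr_deriv (by ring))
  have h3 : HasDerivAt (fun m => 8 * m * Real.cos φ ^ 2) (8 * Real.cos φ ^ 2) m := by
    simpa using ((hasDerivAt_id m).const_mul 8).mul_const (Real.cos φ ^ 2)
  refine ⟨_, (h3.mul h1).congr_deriv ?_,
    (((Real.hasDerivAt_sin φ).const_mul 4).mul (Real.hasDerivAt_cos φ)).mul h2⟩
  simp only [Pi.mul_apply]
  linear_combination (4 * densityProfile (m * Real.sin φ ^ 2)) * Real.sin_sq_add_cos_sq φ

/-- The exact term `d` integrates to zero over a full turn, leaving four times the period. -/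
theorem hasDerivAt_areaAction {m : ℝ} (hm : m ∈ Ioo (0 : ℝ) (1 / 2)) :
    HasDerivAt areaAction (-4 * meanTime m) m := by
  choose d h1 h2 using hasDerivAt_areaIntegrand hm
  have hw := continuous_timeDensity hm
  have hf : ContDiffOn ℝ ∞
      (fun z : ℝ × ℝ => 8 * z.2 * Real.cos z.1 ^ 2 * timeDensity z.1 z.2)
      (univ ×ˢ Ioo 0 (1 / 2)) :=
    ContDiffOn.mul (by fun_prop) contDiffOn_timeDensity
  have h := hasDerivAt_intervalIntegral_of_contDiffOn isOpen_Ioo hf hm h1 0 (2 * Real.pi)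
  have hB : ContDiff ℝ ∞ fun φ => 4 * Real.sin φ * Real.cos φ * timeDensity φ m :=
    ContDiff.mul (by fun_prop) (contDiffOn_univ.1
      (contDiffOn_timeDensity.comp (f := fun φ : ℝ => (φ, m)) (by fun_prop)
        fun _ _ => ⟨mem_univ _, hm⟩))
  have hd : Continuous d := by
    have : d = deriv fun φ => 4 * Real.sin φ * Real.cos φ * timeDensity φ m :=
      funext fun φ => (h2 φ).deriv.symm
    rw [this]
    exact hB.continuous_deriv (by simp)
  have hint : ∫ φ in (0 : ℝ)..(2 * Real.pi), (4 * timeDensity φ m + d φ)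
      = 4 * timeFunction (2 * Real.pi) m := by
    rw [intervalIntegral.integral_add ((hw.const_mul 4).intervalIntegrable _ _)
      (hd.intervalIntegrable _ _), intervalIntegral.integral_const_mul,
      intervalIntegral.integral_eq_sub_of_hasDerivAt (fun φ _ => h2 φ)
        (hd.intervalIntegrable _ _)]
    simp [timeFunction]
  rw [hint] at h
  refine (h.neg.div_const (2 * Real.pi)).congr_deriv ?_
  unfold meanTime
  ring

end

/-! ### Reduction to complete elliptic integrals -/

theorem integral_zero_two_pi_eq_four_mul {f : ℝ → ℝ} (hf : Continuous f)
    (hper : ∀ φ, f (φ + Real.pi) = f φ) (hsymm : ∀ φ, f (Real.pi - φ) = f φ) :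
    ∫ φ in (0 : ℝ)..(2 * Real.pi), f φ = 4 * ∫ φ in (0 : ℝ)..(Real.pi / 2), f φ := by
  have hi := fun a b => hf.intervalIntegrable (μ := volume) a b
  have h1 := intervalIntegral.integral_add_adjacent_intervals (hi 0 (Real.pi / 2))
    (hi (Real.pi / 2) Real.pi)
  have h2 := intervalIntegral.integral_add_adjacent_intervals (hi 0 Real.pi)
    (hi Real.pi (2 * Real.pi))
  have h3 := intervalIntegral.integral_comp_sub_left (a := 0) (b := Real.pi / 2) f Real.pi
  have h4 := intervalIntegral.integral_comp_add_right (a := 0) (b := Real.pi) f Real.pi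
  simp only [hsymm, sub_zero, sub_half] at h3
  simp only [hper, zero_add, ← two_mul] at h4
  linarith

theorem continuous_ellipticK_integrand {m : ℝ} (hm : m ∈ Ioo (0 : ℝ) (1 / 2)) :
    Continuous fun φ => 1 / Real.sqrt (1 - m * Real.sin φ ^ 2) :=
  continuous_const.div (by fun_prop) fun φ =>
    (Real.sqrt_pos.2 (one_sub_mul_sin_sq_pos hm φ)).ne'

theorem continuous_ellipticPi_integrand {m : ℝ} (hm : m ∈ Ioo (0 : ℝ) (1 / 2)) :
    Continuous fun φ =>
      1 / ((1 - 2 * m * Real.sin φ ^ 2) * Real.sqrt (1 - m * Real.sin φ ^ 2)) :=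
  continuous_const.div (by fun_prop) fun φ =>
    (mul_pos (one_sub_two_mul_sin_sq_pos hm φ)
      (Real.sqrt_pos.2 (one_sub_mul_sin_sq_pos hm φ))).ne'

noncomputable section

theorem timeDensity_eq_div_sq (φ m : ℝ) :
    timeDensity φ m = Real.sqrt 2 / 4 *
      (1 / ((1 - 2 * m * Real.sin φ ^ 2) ^ 2 * Real.sqrt (1 - m * Real.sin φ ^ 2))) := by
  unfold timeDensity
  ring

/-- An antiderivative which reduces the period integral to Legendre's normal forms. -/
theorem hasDerivAt_legendre_reduction {m : ℝ} (hm : m ∈ Ioo (0 : ℝ) (1 / 2)) (φ : ℝ) :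
    HasDerivAt (fun φ => 4 * m * (Real.sin φ * Real.cos φ *
        Real.sqrt (1 - m * Real.sin φ ^ 2) / (1 - 2 * m * Real.sin φ ^ 2)))
      (2 * Real.sqrt (1 - m * Real.sin φ ^ 2) - 1 / Real.sqrt (1 - m * Real.sin φ ^ 2)
        + 1 / ((1 - 2 * m * Real.sin φ ^ 2) * Real.sqrt (1 - m * Real.sin φ ^ 2))
        - 4 * Real.sqrt 2 * (1 - 2 * m) * timeDensity φ m) φ := by
  have hD := one_sub_two_mul_sin_sq_pos hm φ
  have hΔ := one_sub_mul_sin_sq_pos hm φ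
  have hs := Real.sqrt_pos.2 hΔ
  have h1 : HasDerivAt (fun φ => 1 - m * Real.sin φ ^ 2)
      (-(2 * m * Real.sin φ * Real.cos φ)) φ :=
    ((((Real.hasDerivAt_sin φ).pow 2).const_mul m).const_sub 1).congr_deriv (by ring)
  have h2 : HasDerivAt (fun φ => 1 - 2 * m * Real.sin φ ^ 2)
      (-(4 * m * Real.sin φ * Real.cos φ)) φ :=
    ((((Real.hasDerivAt_sin φ).pow 2).const_mul (2 * m)).const_sub 1).congr_deriv (by ring)
  refine ((((((Real.hasDerivAt_sin φ).mul (Real.hasDerivAt_cos φ)).mul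
    (h1.sqrt hΔ.ne')).div h2 hD.ne').const_mul (4 * m))).congr_deriv ?_
  have hsq : Real.sqrt (1 - m * Real.sin φ ^ 2) ^ 2 = 1 - m * Real.sin φ ^ 2 :=
    Real.sq_sqrt hΔ.le
  have h22 : Real.sqrt 2 ^ 2 = 2 := Real.sq_sqrt (by norm_num)
  have hc : Real.cos φ ^ 2 = 1 - Real.sin φ ^ 2 := Real.cos_sq' φ
  rw [timeDensity_eq_div_sq]
  simp only [Pi.mul_apply]
  generalize Real.sqrt (1 - m * Real.sin φ ^ 2) = Δ at *
  generalize hDD : 1 - 2 * m * Real.sin φ ^ 2 = D at *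
  generalize Real.sin φ = x at *
  generalize Real.cos φ = c at *
  generalize Real.sqrt 2 = r at *
  field_simp
  subst hDD
  grind

theorem modulus_sq {h : ℝ} (hh : h ∈ Ioo (-2 : ℝ) 0) : modulus h ^ 2 = (2 + h) / 4 := by
  rw [modulus, div_pow, Real.sq_sqrt (by linarith [hh.1])]
  norm_num

theorem modulus_sq_mem {h : ℝ} (hh : h ∈ Ioo (-2 : ℝ) 0) :
    modulus h ^ 2 ∈ Ioo (0 : ℝ) (1 / 2) := by
  rw [modulus_sq hh]
  constructor <;> linarith [hh.1, hh.2]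

/-- The antiderivative of `hasDerivAt_legendre_reduction` contains sin φ cos φ and so vanishes at
both ends of the quarter period. -/
theorem legendre_reduction {h : ℝ} (hh : h ∈ Ioo (-2 : ℝ) 0) :
    2 * ellipticE (modulus h) - ellipticK (modulus h)
        + ellipticPi (2 * modulus h ^ 2) (modulus h)
      = 4 * Real.sqrt 2 * (1 - 2 * modulus h ^ 2) *
        ∫ φ in (0 : ℝ)..(Real.pi / 2), timeDensity φ (modulus h ^ 2) := by
  have hm := modulus_sq_mem hh
  have cE : Continuous fun φ => 2 * Real.sqrt (1 - modulus h ^ 2 * Real.sin φ ^ 2) := by fun_prop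
  have cK := continuous_ellipticK_integrand hm
  have cP := continuous_ellipticPi_integrand hm
  have cw := (continuous_timeDensity hm).const_mul
    (4 * Real.sqrt 2 * (1 - 2 * modulus h ^ 2))
  have cEK : Continuous fun φ => 2 * Real.sqrt (1 - modulus h ^ 2 * Real.sin φ ^ 2)
      - 1 / Real.sqrt (1 - modulus h ^ 2 * Real.sin φ ^ 2) := cE.sub cK
  have cEKP : Continuous fun φ => 2 * Real.sqrt (1 - modulus h ^ 2 * Real.sin φ ^ 2)
      - 1 / Real.sqrt (1 - modulus h ^ 2 * Real.sin φ ^ 2)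
      + 1 / ((1 - 2 * modulus h ^ 2 * Real.sin φ ^ 2) *
        Real.sqrt (1 - modulus h ^ 2 * Real.sin φ ^ 2)) := cEK.add cP
  have hi : ∀ {f : ℝ → ℝ}, Continuous f → IntervalIntegrable f volume 0 (Real.pi / 2) :=
    fun hf => hf.intervalIntegrable _ _
  have h1 := intervalIntegral.integral_eq_sub_of_hasDerivAt (a := 0) (b := Real.pi / 2)
    (fun φ _ => hasDerivAt_legendre_reduction hm φ) (hi (cEKP.sub cw))
  rw [intervalIntegral.integral_sub (hi cEKP) (hi cw),
    intervalIntegral.integral_add (hi cEK) (hi cP),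
    intervalIntegral.integral_sub (hi cE) (hi cK),
    intervalIntegral.integral_const_mul, intervalIntegral.integral_const_mul] at h1
  simp only [Real.sin_zero, Real.cos_pi_div_two, mul_zero, zero_mul, zero_div, sub_zero] at h1
  unfold ellipticE ellipticK ellipticPi
  linarith

theorem timeFunction_two_pi {m : ℝ} (hm : m ∈ Ioo (0 : ℝ) (1 / 2)) :
    timeFunction (2 * Real.pi) m = 4 * ∫ φ in (0 : ℝ)..(Real.pi / 2), timeDensity φ m :=
  integral_zero_two_pi_eq_four_mul (continuous_timeDensity hm)
    (fun φ => by simp [timeDensity]) (fun φ => by simp [timeDensity])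

theorem returnOmega_eq {h : ℝ} (hh : h ∈ Ioo (-2 : ℝ) 0) :
    returnOmega h = meanTime (modulus h ^ 2) := by
  have hm := modulus_sq_mem hh
  have h22 : Real.sqrt 2 ^ 2 = 2 := Real.sq_sqrt (by norm_num)
  have h1 : 1 - 2 * modulus h ^ 2 ≠ 0 := by linarith [hm.2]
  rw [returnOmega, legendre_reduction hh, meanTime, timeFunction_two_pi hm]
  have hpi := Real.pi_pos.ne'
  field_simp
  rw [h22]
  ring

theorem actionJ_eq {h : ℝ} (hh : h ∈ Ioo (-2 : ℝ) 0) :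
    actionJ h = areaAction (modulus h ^ 2) := by
  have hm := modulus_sq_mem hh
  have h22 : Real.sqrt 2 ^ 2 = 2 := Real.sq_sqrt (by norm_num)
  have cw := continuous_timeDensity hm
  have cP := continuous_ellipticPi_integrand hm
  have hr := legendre_reduction hh
  -- From 8m cos² φ = 4(1 - 2m sin² φ) - 4(1 - 2m): the first term lowers the power in the
  -- denominator and gives the integrand of Π, the second is covered by `legendre_reduction`.
  have key : ∀ φ, 8 * modulus h ^ 2 * Real.cos φ ^ 2 * timeDensity φ (modulus h ^ 2)
      = Real.sqrt 2 * (1 / ((1 - 2 * modulus h ^ 2 * Real.sin φ ^ 2) *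
          Real.sqrt (1 - modulus h ^ 2 * Real.sin φ ^ 2)))
        - 4 * (1 - 2 * modulus h ^ 2) * timeDensity φ (modulus h ^ 2) := by
    intro φ
    have hD := (one_sub_two_mul_sin_sq_pos hm φ).ne'
    have hs := (Real.sqrt_pos.2 (one_sub_mul_sin_sq_pos hm φ)).ne'
    rw [timeDensity_eq_div_sq, Real.cos_sq']
    field_simp
    ring
  have h4 := integral_zero_two_pi_eq_four_mul
    (f := fun φ => 8 * modulus h ^ 2 * Real.cos φ ^ 2 * timeDensity φ (modulus h ^ 2))
    (by fun_prop) (fun φ => by simp [timeDensity]) (fun φ => by simp [timeDensity])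
  rw [areaAction, h4]
  simp only [key]
  rw [intervalIntegral.integral_sub ((cP.const_mul _).intervalIntegrable _ _)
    ((cw.const_mul _).intervalIntegrable _ _), intervalIntegral.integral_const_mul,
    intervalIntegral.integral_const_mul, actionJ]
  have hP : ellipticPi (2 * modulus h ^ 2) (modulus h) = ∫ φ in (0 : ℝ)..(Real.pi / 2),
      1 / ((1 - 2 * modulus h ^ 2 * Real.sin φ ^ 2) *
        Real.sqrt (1 - modulus h ^ 2 * Real.sin φ ^ 2)) := rfl
  rw [← hP]
  have hpi := Real.pi_pos.ne'
  field_simp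
  linear_combination 2 * Real.sqrt 2 * hr + 8 * (1 - 2 * modulus h ^ 2) *
    (∫ φ in (0 : ℝ)..(Real.pi / 2), timeDensity φ (modulus h ^ 2)) * h22

end

/-! ### The one-dimensional Sitnikov problem -/

noncomputable section

/-- The partial energy of a single secondary. -/
def energyOne (y : ℝ × ℝ) : ℝ := y.2 ^ 2 / 2 - 1 / Real.sqrt (y.1 ^ 2 + 1 / 4)

/-- The derivative of the partial energy with respect to the position. -/
def energySlope (q : ℝ) : ℝ := q / Real.sqrt (q ^ 2 + 1 / 4) ^ 3

/-- The Hamiltonian vector field of a single secondary with sign convention `s`. -/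
def sitnikovField (s : ℝ) (y : ℝ × ℝ) : ℝ × ℝ := (-(s * y.2), s * energySlope y.1)

theorem hasDerivAt_potential (q : ℝ) :
    HasDerivAt (fun q : ℝ => -(1 / Real.sqrt (q ^ 2 + 1 / 4))) (energySlope q) q := by
  have hq : 0 < q ^ 2 + 1 / 4 := by positivity
  have hs := Real.sqrt_pos.2 hq
  have h1 : HasDerivAt (fun q : ℝ => q ^ 2 + 1 / 4) (2 * q) q := by
    simpa using (hasDerivAt_pow 2 q).add_const (1 / 4)
  have h2 := ((hasDerivAt_const q (1 : ℝ)).div (h1.sqrt hq.ne') hs.ne').neg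
  refine h2.congr_deriv ?_
  unfold energySlope
  field_simp
  ring

theorem hasFDerivAt_energyOne (y : ℝ × ℝ) :
    HasFDerivAt energyOne (y.2 • ContinuousLinearMap.snd ℝ ℝ ℝ
      + energySlope y.1 • ContinuousLinearMap.fst ℝ ℝ ℝ) y := by
  have h1 : HasFDerivAt (fun y : ℝ × ℝ => -(1 / Real.sqrt (y.1 ^ 2 + 1 / 4)))
      (energySlope y.1 • ContinuousLinearMap.fst ℝ ℝ ℝ) y :=
    (hasDerivAt_potential y.1).comp_hasFDerivAt y hasFDerivAt_fst
  have h2 : HasFDerivAt (fun y : ℝ × ℝ => y.2 ^ 2 / 2)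
      (y.2 • ContinuousLinearMap.snd ℝ ℝ ℝ) y := by
    have h3 : HasDerivAt (fun p : ℝ => p ^ 2 / 2) y.2 y.2 := by
      simpa using (hasDerivAt_pow 2 y.2).div_const 2
    exact h3.comp_hasFDerivAt y hasFDerivAt_snd
  refine (h2.add h1).congr_of_eventuallyEq (Eventually.of_forall fun y => ?_)
  simp [energyOne, sub_eq_add_neg]

theorem hasDerivAt_energySlope (q : ℝ) :
    HasDerivAt energySlope ((1 / 4 - 2 * q ^ 2) / Real.sqrt (q ^ 2 + 1 / 4) ^ 5) q := by
  have hq : 0 < q ^ 2 + 1 / 4 := by positivity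
  have hs := Real.sqrt_pos.2 hq
  have h1 : HasDerivAt (fun q : ℝ => q ^ 2 + 1 / 4) (2 * q) q := by
    simpa using (hasDerivAt_pow 2 q).add_const (1 / 4)
  have h2 := (hasDerivAt_id q).div ((h1.sqrt hq.ne').pow 3) (pow_ne_zero 3 hs.ne')
  refine h2.congr_deriv ?_
  have hsq := Real.sq_sqrt hq.le
  simp only [Pi.pow_apply, id]
  generalize Real.sqrt (q ^ 2 + 1 / 4) = r at *
  field_simp
  grind

/-- With r = √(q² + 1/4) ≥ 1/2 the derivative is at most 2r²/r⁵ ≤ 16, so 64 is not sharp. Only a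
global bound matters, for uniqueness of solutions on all of ℝ. -/
theorem lipschitzWith_energySlope : LipschitzWith 64 energySlope := by
  refine lipschitzWith_of_nnnorm_deriv_le (fun q => (hasDerivAt_energySlope q).differentiableAt)
    fun q => ?_
  rw [(hasDerivAt_energySlope q).deriv, ← NNReal.coe_le_coe, coe_nnnorm, Real.norm_eq_abs]
  have hq : 0 < q ^ 2 + 1 / 4 := by positivity
  have hs := Real.sqrt_pos.2 hq
  have hsq := Real.sq_sqrt hq.le
  have hr : 1 / 2 ≤ Real.sqrt (q ^ 2 + 1 / 4) := Real.le_sqrt_of_sq_le (by nlinarith [sq_nonneg q])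
  rw [abs_div, abs_of_pos (pow_pos hs 5), div_le_iff₀ (pow_pos hs 5)]
  have h1 : |1 / 4 - 2 * q ^ 2| ≤ 2 * Real.sqrt (q ^ 2 + 1 / 4) ^ 2 := by
    rw [hsq, abs_le]; constructor <;> nlinarith [sq_nonneg q]
  generalize Real.sqrt (q ^ 2 + 1 / 4) = r at *
  have h3 : (1 / 2 : ℝ) ^ 3 ≤ r ^ 3 := by gcongr
  have : r ^ 2 * (1 / 2 : ℝ) ^ 3 ≤ r ^ 2 * r ^ 3 := by gcongr
  push_cast
  nlinarith [pow_pos hs 2]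

theorem lipschitzWith_sitnikovField (s : ℝ) :
    ∃ C, LipschitzWith C (sitnikovField s) := by
  have h1 : LipschitzWith _ fun y : ℝ × ℝ => -(s * y.2) :=
    ((lipschitzWith_smul s).comp LipschitzWith.prod_snd).neg
  have h2 : LipschitzWith _ fun y : ℝ × ℝ => s * energySlope y.1 :=
    (lipschitzWith_smul s).comp (lipschitzWith_energySlope.comp LipschitzWith.prod_fst)
  exact ⟨_, h1.prodMk h2⟩

theorem sitnikovField_solution_unique {s : ℝ} {x y : ℝ → ℝ × ℝ}
    (hx : ∀ t, HasDerivAt x (sitnikovField s (x t)) t)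
    (hy : ∀ t, HasDerivAt y (sitnikovField s (y t)) t) (h0 : x 0 = y 0) : x = y := by
  obtain ⟨C, hC⟩ := lipschitzWith_sitnikovField s
  exact ODE_solution_unique_univ (v := fun _ => sitnikovField s) (s := fun _ => univ) (K := C)
    (fun _ => hC.lipschitzOnWith) (fun t => ⟨hx t, mem_univ _⟩) (fun t => ⟨hy t, mem_univ _⟩) h0

/-- The position as a function of `X = √m sin φ`. -/
def positionProfile (X : ℝ) : ℝ := X * Real.sqrt (1 - X ^ 2) / (1 - 2 * X ^ 2)

/-- This rests on 4X²(1 - X²) + (1 - 2X²)² = 1. It is what makes the potential quadratic in X. -/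
theorem sqrt_positionProfile {X : ℝ} (hX : 0 < 1 - 2 * X ^ 2) :
    Real.sqrt (positionProfile X ^ 2 + 1 / 4) = 1 / (2 * (1 - 2 * X ^ 2)) := by
  have h1 : 0 ≤ 1 - X ^ 2 := by nlinarith [sq_nonneg X]
  rw [Real.sqrt_eq_iff_mul_self_eq (by positivity) (by positivity), positionProfile, div_pow,
    mul_pow, Real.sq_sqrt h1]
  generalize hD : 1 - 2 * X ^ 2 = D at *
  field_simp
  subst hD
  ring

theorem energySlope_positionProfile {X : ℝ} (hX : 0 < 1 - 2 * X ^ 2) :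
    energySlope (positionProfile X) = 8 * X * Real.sqrt (1 - X ^ 2) * (1 - 2 * X ^ 2) ^ 2 := by
  rw [energySlope, sqrt_positionProfile hX, positionProfile]
  generalize 1 - 2 * X ^ 2 = D at *
  field_simp
  norm_num

theorem hasDerivAt_positionProfile {X : ℝ} (hX : 0 < 1 - 2 * X ^ 2) :
    HasDerivAt positionProfile (1 / ((1 - 2 * X ^ 2) ^ 2 * Real.sqrt (1 - X ^ 2))) X := by
  have h1 : 0 < 1 - X ^ 2 := by nlinarith [sq_nonneg X]
  have hs := Real.sqrt_pos.2 h1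
  have h2 : HasDerivAt (fun X : ℝ => 1 - X ^ 2) (-(2 * X)) X := by
    simpa using (hasDerivAt_pow 2 X).const_sub 1
  have h3 : HasDerivAt (fun X : ℝ => 1 - 2 * X ^ 2) (-(4 * X)) X :=
    (((hasDerivAt_pow 2 X).const_mul 2).const_sub 1).congr_deriv (by norm_num; ring)
  refine (((hasDerivAt_id X).mul (h2.sqrt h1.ne')).div h3 hX.ne').congr_deriv ?_
  have hsq := Real.sq_sqrt h1.le
  simp only [Pi.mul_apply, id]
  generalize Real.sqrt (1 - X ^ 2) = r at *
  field_simp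
  grind

/-- The value of √(q² + 1/4) determines X²; the remaining factors of q are then equal and nonzero,
so they cancel. -/
theorem positionProfile_injOn {X Y : ℝ} (hX : 0 < 1 - 2 * X ^ 2) (hY : 0 < 1 - 2 * Y ^ 2)
    (h : positionProfile X = positionProfile Y) : X = Y := by
  have h1 := sqrt_positionProfile hX
  rw [h, sqrt_positionProfile hY] at h1
  have h2 : 1 - 2 * X ^ 2 = 1 - 2 * Y ^ 2 := by
    field_simp at h1
    linarith
  have h3 : X ^ 2 = Y ^ 2 := by linarith
  have hs : 0 < Real.sqrt (1 - Y ^ 2) := Real.sqrt_pos.2 (by nlinarith [sq_nonneg Y])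
  rw [positionProfile, positionProfile, h2, h3, div_left_inj' hY.ne'] at h
  exact mul_right_cancel₀ hs.ne' h

/-- For X = sin a with |a| < π/4 the profile is sin a cos a / cos 2a = tan(2a)/2, hence the choice
of a. -/
theorem exists_positionProfile_eq (q : ℝ) : ∃ X, 0 < 1 - 2 * X ^ 2 ∧ positionProfile X = q := by
  set a := Real.arctan (2 * q) / 2 with ha
  have h2a : Real.arctan (2 * q) = 2 * a := by rw [ha]; ring
  have h1 : 1 - 2 * Real.sin a ^ 2 = Real.cos (2 * a) := by
    rw [Real.cos_two_mul, Real.cos_sq']; ring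
  have hc2 : 0 < Real.cos (2 * a) := h2a ▸ Real.cos_arctan_pos _
  have hc : 0 < Real.cos a := Real.cos_pos_of_mem_Ioo
    ⟨by linarith [Real.neg_pi_div_two_lt_arctan (2 * q), Real.pi_pos],
      by linarith [Real.arctan_lt_pi_div_two (2 * q), Real.pi_pos]⟩
  refine ⟨Real.sin a, h1 ▸ hc2, ?_⟩
  have ht : Real.sin (2 * a) / Real.cos (2 * a) = 2 * q := by
    rw [← Real.tan_eq_sin_div_cos, ← h2a, Real.tan_arctan]
  rw [positionProfile, h1, ← Real.cos_sq', Real.sqrt_sq hc.le]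
  rw [Real.sin_two_mul] at ht
  linear_combination ht / 2

/-- The level set of energy `4 m - 2`, parametrized by `φ`. -/
def orbit (s φ m : ℝ) : ℝ × ℝ :=
  (positionProfile (Real.sqrt m * Real.sin φ),
    -(s * (2 * Real.sqrt 2 * (Real.sqrt m * Real.cos φ))))

theorem sqrt_mul_sin_sq {m : ℝ} (hm : m ∈ Ioo (0 : ℝ) (1 / 2)) (φ : ℝ) :
    (Real.sqrt m * Real.sin φ) ^ 2 = m * Real.sin φ ^ 2 := by
  rw [mul_pow, Real.sq_sqrt hm.1.le]

theorem profile_pos {m : ℝ} (hm : m ∈ Ioo (0 : ℝ) (1 / 2)) (φ : ℝ) :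
    0 < 1 - 2 * (Real.sqrt m * Real.sin φ) ^ 2 := by
  rw [sqrt_mul_sin_sq hm, ← mul_assoc]
  exact one_sub_two_mul_sin_sq_pos hm φ

theorem energyOne_positionProfile {s X Y : ℝ} (hs : s * s = 1) (hX : 0 < 1 - 2 * X ^ 2) :
    energyOne (positionProfile X, -(s * (2 * Real.sqrt 2 * Y))) = 4 * (X ^ 2 + Y ^ 2) - 2 := by
  have h22 : Real.sqrt 2 ^ 2 = 2 := Real.sq_sqrt (by norm_num)
  simp only [energyOne, sqrt_positionProfile hX]
  field_simp
  linear_combination (2 * s ^ 2 * Y ^ 2) * h22 + 4 * Y ^ 2 * hs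

theorem energyOne_orbit {s m : ℝ} (hs : s * s = 1) (hm : m ∈ Ioo (0 : ℝ) (1 / 2)) (φ : ℝ) :
    energyOne (orbit s φ m) = 4 * m - 2 := by
  rw [orbit, energyOne_positionProfile hs (profile_pos hm φ), mul_pow, mul_pow,
    Real.sq_sqrt hm.1.le]
  linear_combination 4 * m * Real.sin_sq_add_cos_sq φ

theorem contDiffOn_orbit (s : ℝ) :
    ContDiffOn ℝ ∞ (fun z : ℝ × ℝ => orbit s z.1 z.2) (univ ×ˢ Ioo 0 (1 / 2)) := by
  have h1 : ContDiffOn ℝ ∞ (fun z : ℝ × ℝ => Real.sqrt z.2) (univ ×ˢ Ioo 0 (1 / 2)) :=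
    ContDiffOn.sqrt (by fun_prop) fun z hz => hz.2.1.ne'
  have hX : ContDiffOn ℝ ∞ (fun z : ℝ × ℝ => Real.sqrt z.2 * Real.sin z.1)
      (univ ×ˢ Ioo 0 (1 / 2)) := h1.mul (by fun_prop)
  have hY : ContDiffOn ℝ ∞ (fun z : ℝ × ℝ => Real.sqrt z.2 * Real.cos z.1)
      (univ ×ˢ Ioo 0 (1 / 2)) := h1.mul (by fun_prop)
  unfold orbit positionProfile
  refine ContDiffOn.prodMk (ContDiffOn.div (hX.mul (ContDiffOn.sqrt
    (contDiffOn_const.sub (hX.pow 2)) ?_)) (contDiffOn_const.sub (contDiffOn_const.mul (hX.pow 2)))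
    fun z hz => (profile_pos hz.2 z.1).ne') (contDiffOn_const.mul (contDiffOn_const.mul hY)).neg
  intro z hz
  have := profile_pos hz.2 z.1
  nlinarith [sq_nonneg (Real.sqrt z.2 * Real.sin z.1)]

theorem hasDerivAt_orbit {s m : ℝ} (hs : s * s = 1) (hm : m ∈ Ioo (0 : ℝ) (1 / 2)) (φ : ℝ) :
    HasDerivAt (fun φ => orbit s φ m) (timeDensity φ m • sitnikovField s (orbit s φ m)) φ := by
  have hX := profile_pos hm φ
  have hΔ : 0 < Real.sqrt (1 - (Real.sqrt m * Real.sin φ) ^ 2) :=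
    Real.sqrt_pos.2 (by nlinarith [sq_nonneg (Real.sqrt m * Real.sin φ)])
  have h22 : Real.sqrt 2 ^ 2 = 2 := Real.sq_sqrt (by norm_num)
  have h1 := HasDerivAt.comp (h₂ := positionProfile) φ (hasDerivAt_positionProfile hX)
    ((Real.hasDerivAt_sin φ).const_mul (Real.sqrt m))
  have h2 := ((((Real.hasDerivAt_cos φ).const_mul (Real.sqrt m)).const_mul
    (2 * Real.sqrt 2)).const_mul s).neg
  refine (h1.prodMk h2).congr_deriv ?_
  have hw : timeDensity φ m = Real.sqrt 2 / 4 / ((1 - 2 * (Real.sqrt m * Real.sin φ) ^ 2) ^ 2 *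
      Real.sqrt (1 - (Real.sqrt m * Real.sin φ) ^ 2)) := by
    rw [sqrt_mul_sin_sq hm, timeDensity, mul_assoc]
  simp only [sitnikovField, orbit, energySlope_positionProfile hX, hw, Prod.smul_mk, smul_eq_mul]
  generalize 1 - 2 * (Real.sqrt m * Real.sin φ) ^ 2 = D at *
  generalize Real.sqrt (1 - (Real.sqrt m * Real.sin φ) ^ 2) = r at *
  refine Prod.ext ?_ ?_ <;> simp only <;> field_simp
  · linear_combination -(Real.sqrt m * Real.cos φ) * (2 * h22 * s ^ 2 + 4 * hs)
  · ring

/-- The energy recovers m, the position recovers sin φ and the momentum recovers cos φ. -/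
theorem orbit_eq_iff {s m m' φ φ' : ℝ} (hs : s * s = 1) (hm : m ∈ Ioo (0 : ℝ) (1 / 2))
    (hm' : m' ∈ Ioo (0 : ℝ) (1 / 2)) :
    orbit s φ m = orbit s φ' m' ↔ m = m' ∧ ∃ n : ℤ, φ = φ' + 2 * Real.pi * n := by
  constructor
  · intro h
    have he := congrArg energyOne h
    rw [energyOne_orbit hs hm, energyOne_orbit hs hm'] at he
    obtain rfl : m = m' := by linarith
    refine ⟨rfl, ?_⟩
    have hr : Real.sqrt m ≠ 0 := (Real.sqrt_pos.2 hm.1).ne'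
    have h2 : Real.sqrt 2 ≠ 0 := by positivity
    have hs0 : s ≠ 0 := left_ne_zero_of_mul_eq_one hs
    obtain ⟨hq, hp⟩ := Prod.mk.inj h
    have hsin := mul_left_cancel₀ hr (positionProfile_injOn (profile_pos hm φ)
      (profile_pos hm φ') hq)
    have hcos : Real.cos φ = Real.cos φ' := by
      simpa [hs0, h2, hr] using hp
    obtain ⟨n, hn⟩ := Real.Angle.angle_eq_iff_two_pi_dvd_sub.1
      (Real.Angle.cos_sin_inj hcos hsin)
    exact ⟨n, by linarith⟩
  · rintro ⟨rfl, n, rfl⟩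
    have h1 : φ' + 2 * Real.pi * n = φ' + n * (2 * Real.pi) := by ring
    simp [orbit, h1, Real.sin_add_int_mul_two_pi, Real.cos_add_int_mul_two_pi]

theorem exists_orbit_eq {s : ℝ} (hs : s * s = 1) {y : ℝ × ℝ}
    (hy : energyOne y ∈ Ioo (-2 : ℝ) 0) :
    ∃ φ, ∃ m ∈ Ioo (0 : ℝ) (1 / 2), orbit s φ m = y := by
  obtain ⟨X, hX, hq⟩ := exists_positionProfile_eq y.1
  set Y := -(s * y.2) / (2 * Real.sqrt 2) with hY
  have hp : -(s * (2 * Real.sqrt 2 * Y)) = y.2 := by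
    rw [hY]
    field_simp
    linear_combination y.2 * hs
  have hy' : y = (positionProfile X, -(s * (2 * Real.sqrt 2 * Y))) := by rw [hq, hp]
  have he := energyOne_positionProfile (Y := Y) hs hX
  rw [← hy'] at he
  rw [he] at hy
  have hm : X ^ 2 + Y ^ 2 ∈ Ioo (0 : ℝ) (1 / 2) := by
    constructor <;> linarith [hy.1, hy.2]
  -- Polar coordinates with Y as real and X as imaginary part, since Y carries the cosine and X the
  -- sine.
  refine ⟨Complex.arg ⟨Y, X⟩, X ^ 2 + Y ^ 2, hm, ?_⟩
  have hn : ‖(⟨Y, X⟩ : ℂ)‖ = Real.sqrt (X ^ 2 + Y ^ 2) := by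
    rw [Complex.norm_def, Complex.normSq_mk]; congr 1; ring
  rw [orbit, ← hn, Complex.norm_mul_sin_arg, Complex.norm_mul_cos_arg, ← hy']

end

/-! ### Action-angle coordinates for one degree of freedom -/

/-- An injective smooth map with invertible derivatives has an open image and a smooth inverse. -/
theorem smooth_invFunOn {E : Type} [NormedAddCommGroup E] [NormedSpace ℝ E]
    [FiniteDimensional ℝ E] {f : E → E} {S : Set E} (hS : IsOpen S) (hf : ContDiffOn ℝ ∞ f S)
    (hinj : InjOn f S) (hker : ∀ x ∈ S, ∀ v, fderiv ℝ f x v = 0 → v = 0) [Nonempty E] :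
    IsOpen (f '' S) ∧ ContDiffOn ℝ ∞ (Function.invFunOn f S) (f '' S) := by
  have hcomplete : CompleteSpace E := FiniteDimensional.complete ℝ E
  have key : ∀ x ∈ S, f '' S ∈ 𝓝 (f x) ∧ ContDiffAt ℝ ∞ (Function.invFunOn f S) (f x) := by
    intro x hx
    have hfx : ContDiffAt ℝ ∞ f x := hf.contDiffAt (hS.mem_nhds hx)
    have hi : Function.Injective (fderiv ℝ f x).toLinearMap :=
      (injective_iff_map_eq_zero _).2 fun v hv => hker x hx v hv
    let e : E ≃L[ℝ] E := (LinearEquiv.ofInjectiveEndo _ hi).toContinuousLinearEquiv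
    have he : HasFDerivAt f (e : E →L[ℝ] E) x :=
      (hfx.differentiableAt (by simp)).hasFDerivAt.congr_fderiv (by ext v; rfl)
    have hg := hfx.to_localInverse he (by simp)
    have hright : ∀ᶠ y in 𝓝 (f x), f (hfx.localInverse he (by simp) y) = y :=
      (hfx.hasStrictFDerivAt' he (by simp)).eventually_right_inverse
    have hmem : ∀ᶠ y in 𝓝 (f x), hfx.localInverse he (by simp) y ∈ S := by
      refine hg.continuousAt.eventually_mem ?_
      rw [hfx.localInverse_apply_image he (by simp)]
      exact hS.mem_nhds hx
    have himg : f '' S ∈ 𝓝 (f x) := by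
      filter_upwards [hright, hmem] with y h1 h2
      exact ⟨_, h2, h1⟩
    -- Injectivity on `S` forces the global inverse to agree near `f x` with the local one from the
    -- inverse function theorem.
    refine ⟨himg, hg.congr_of_eventuallyEq ?_⟩
    filter_upwards [hright, hmem, himg] with y h1 h2 h3
    exact hinj (Function.invFunOn_mem h3) h2 ((Function.invFunOn_eq h3).trans h1.symm)
  constructor
  · rw [isOpen_iff_mem_nhds]
    rintro _ ⟨x, hx, rfl⟩
    exact (key x hx).1
  · rintro _ ⟨x, hx, rfl⟩
    exact (key x hx).2.contDiffWithinAt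

noncomputable section

/-- Angle and action as functions of `φ` and `m`. -/
def angleAction (s : ℝ) (z : ℝ × ℝ) : ℝ × ℝ :=
  (timeFunction z.1 z.2 / meanTime z.2, s * areaAction z.2)

/-- The values of the action. -/
def actionDomain (s : ℝ) : Set ℝ := (fun h => s * actionJ h) '' Ioo (-2 : ℝ) 0

theorem actionDomain_eq (s : ℝ) :
    actionDomain s = (fun m => s * areaAction m) '' Ioo (0 : ℝ) (1 / 2) := by
  ext J
  constructor
  · rintro ⟨h, hh, rfl⟩
    exact ⟨_, modulus_sq_mem hh, by simp only [actionJ_eq hh]⟩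
  · rintro ⟨m, hm, rfl⟩
    have hh : 4 * m - 2 ∈ Ioo (-2 : ℝ) 0 := by constructor <;> linarith [hm.1, hm.2]
    refine ⟨_, hh, ?_⟩
    simp only [actionJ_eq hh, modulus_sq hh]
    congr 2
    ring

theorem contDiffOn_meanTime : ContDiffOn ℝ ∞ meanTime (Ioo 0 (1 / 2)) :=
  (contDiffOn_timeFunction.comp (f := fun m : ℝ => (2 * Real.pi, m)) (by fun_prop)
    fun _ hm => ⟨mem_univ _, hm⟩).div_const _

theorem contDiffOn_areaAction : ContDiffOn ℝ ∞ areaAction (Ioo 0 (1 / 2)) := by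
  refine (contDiffOn_infty_iff_deriv_of_isOpen isOpen_Ioo).2 ⟨fun m hm =>
    (hasDerivAt_areaAction hm).differentiableAt.differentiableWithinAt, ?_⟩
  exact (contDiffOn_const.mul contDiffOn_meanTime).congr
    fun m hm => (hasDerivAt_areaAction hm).deriv

theorem strictAntiOn_areaAction : StrictAntiOn areaAction (Ioo 0 (1 / 2)) := by
  refine strictAntiOn_of_deriv_neg (convex_Ioo _ _) contDiffOn_areaAction.continuousOn
    fun m hm => ?_
  rw [interior_Ioo] at hm
  rw [(hasDerivAt_areaAction hm).deriv]
  linarith [meanTime_pos hm]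

theorem contDiffOn_angleAction (s : ℝ) :
    ContDiffOn ℝ ∞ (angleAction s) (univ ×ˢ Ioo 0 (1 / 2)) :=
  (contDiffOn_timeFunction.div (contDiffOn_meanTime.comp contDiffOn_snd fun _ hz => hz.2)
    fun _ hz => (meanTime_pos hz.2).ne').prodMk
    (contDiffOn_const.mul (contDiffOn_areaAction.comp contDiffOn_snd fun _ hz => hz.2))

theorem injOn_angleAction {s : ℝ} (hs : s * s = 1) :
    InjOn (angleAction s) (univ ×ˢ Ioo 0 (1 / 2)) := by
  rintro ⟨φ, m⟩ ⟨-, hm⟩ ⟨φ', m'⟩ ⟨-, hm'⟩ h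
  obtain ⟨h1, h2⟩ := Prod.mk.inj h
  obtain rfl : m = m' := strictAntiOn_areaAction.injOn hm hm'
    (mul_left_cancel₀ (left_ne_zero_of_mul_eq_one hs) h2)
  rw [Prod.mk.injEq]
  exact ⟨(strictMono_timeFunction hm).injective (by
    simpa [(meanTime_pos hm).ne'] using h1), rfl⟩

theorem image_angleAction (s : ℝ) :
    angleAction s '' (univ ×ˢ Ioo 0 (1 / 2)) = univ ×ˢ actionDomain s := by
  rw [actionDomain_eq]
  ext ⟨θ, J⟩
  constructor
  · rintro ⟨⟨φ, m⟩, ⟨-, hm⟩, h⟩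
    exact ⟨mem_univ _, m, hm, congrArg Prod.snd h⟩
  · rintro ⟨-, m, hm, hJ⟩
    obtain ⟨φ, hφ⟩ := surjective_timeFunction hm (θ * meanTime m)
    refine ⟨(φ, m), ⟨mem_univ _, hm⟩, Prod.ext ?_ hJ⟩
    simp only at hφ
    simp [angleAction, hφ, (meanTime_pos hm).ne']

/-- The action does not depend on φ, so the Jacobian is triangular, with nonzero diagonal entries
`timeDensity φ m / meanTime m` and `-4 * s * meanTime m`. -/
theorem fderiv_angleAction_ker {s : ℝ} (hs : s * s = 1) :
    ∀ z ∈ (univ : Set ℝ) ×ˢ Ioo (0 : ℝ) (1 / 2), ∀ v,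
      fderiv ℝ (angleAction s) z v = 0 → v = 0 := by
  rintro ⟨φ, m⟩ ⟨-, hm⟩ ⟨u, v⟩ h
  have hd : HasFDerivAt (angleAction s) (fderiv ℝ (angleAction s) (φ, m)) (φ, m) :=
    (((contDiffOn_angleAction s).contDiffAt
      ((isOpen_univ.prod isOpen_Ioo).mem_nhds ⟨mem_univ _, hm⟩)).differentiableAt
        (by simp)).hasFDerivAt
  set L := fderiv ℝ (angleAction s) (φ, m)
  have hv : (L (u, v)).2 = s * (-4 * meanTime m) * v := by
    have h1 := hasFDerivAt_snd.comp (φ, m) hd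
    have h2 : HasFDerivAt (fun z : ℝ × ℝ => s * areaAction z.2) _ (φ, m) :=
      ((hasDerivAt_areaAction hm).const_mul s).comp_hasFDerivAt (φ, m)
        (hasFDerivAt_snd (𝕜 := ℝ) (p := (φ, m)))
    simpa using DFunLike.congr_fun (h1.unique h2) (u, v)
  have hu : (L (1, 0)).1 = timeDensity φ m / meanTime m := by
    have h1 := hd.comp_hasDerivAt φ ((hasDerivAt_id φ).prodMk (hasDerivAt_const φ m))
    have h2 := hasFDerivAt_fst.comp_hasDerivAt φ h1
    exact h2.unique ((hasDerivAt_timeFunction hm φ).div_const (meanTime m))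
  have hs0 : s ≠ 0 := left_ne_zero_of_mul_eq_one hs
  have hΩ := (meanTime_pos hm).ne'
  rw [h] at hv
  obtain rfl : v = 0 := by simpa [hs0, hΩ] using hv
  have h3 : ((u, 0) : ℝ × ℝ) = u • (1, 0) := by simp
  rw [h3, map_smul] at h
  have h4 := congrArg Prod.fst h
  simp only [Prod.smul_fst, hu, smul_eq_mul, Prod.fst_zero] at h4
  have hw := (timeDensity_pos hm φ).ne'
  obtain rfl : u = 0 := by simpa [hw, hΩ] using h4
  rfl

/-- The inverse of `angleAction`. -/
def angleActionInv (s : ℝ) : ℝ × ℝ → ℝ × ℝ :=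
  Function.invFunOn (angleAction s) (univ ×ˢ Ioo 0 (1 / 2))

theorem contDiffOn_angleActionInv {s : ℝ} (hs : s * s = 1) :
    ContDiffOn ℝ ∞ (angleActionInv s) (univ ×ˢ actionDomain s) := by
  rw [← image_angleAction]
  exact (smooth_invFunOn (isOpen_univ.prod isOpen_Ioo) (contDiffOn_angleAction s)
    (injOn_angleAction hs) (fderiv_angleAction_ker hs)).2

theorem isOpen_actionDomain {s : ℝ} (hs : s * s = 1) : IsOpen (actionDomain s) := by
  have h := (smooth_invFunOn (isOpen_univ.prod isOpen_Ioo) (contDiffOn_angleAction s)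
    (injOn_angleAction hs) (fderiv_angleAction_ker hs)).1
  rw [image_angleAction] at h
  have : actionDomain s = (fun J : ℝ => ((0 : ℝ), J)) ⁻¹' (univ ×ˢ actionDomain s) := by
    ext; simp
  rw [this]
  exact h.preimage (by fun_prop)

theorem mem_image_angleAction {s : ℝ} {z : ℝ × ℝ} (hz : z.2 ∈ actionDomain s) :
    z ∈ angleAction s '' (univ ×ˢ Ioo 0 (1 / 2)) := by
  rw [image_angleAction]
  exact ⟨mem_univ _, hz⟩

theorem angleActionInv_mem {s : ℝ} {z : ℝ × ℝ} (hz : z.2 ∈ actionDomain s) :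
    (angleActionInv s z).2 ∈ Ioo (0 : ℝ) (1 / 2) :=
  (Function.invFunOn_mem (f := angleAction s) (b := z) (mem_image_angleAction hz)).2

theorem angleAction_angleActionInv {s : ℝ} {z : ℝ × ℝ} (hz : z.2 ∈ actionDomain s) :
    angleAction s (angleActionInv s z) = z :=
  Function.invFunOn_eq (f := angleAction s) (b := z) (mem_image_angleAction hz)

theorem angleActionInv_angleAction {s : ℝ} (hs : s * s = 1) {φ m : ℝ}
    (hm : m ∈ Ioo (0 : ℝ) (1 / 2)) : angleActionInv s (angleAction s (φ, m)) = (φ, m) :=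
  (injOn_angleAction hs).leftInvOn_invFunOn ⟨mem_univ _, hm⟩

/-- Action-angle coordinates for a single secondary. -/
def chartOne (s : ℝ) (z : ℝ × ℝ) : ℝ × ℝ :=
  orbit s (angleActionInv s z).1 (angleActionInv s z).2

theorem contDiffOn_chartOne {s : ℝ} (hs : s * s = 1) :
    ContDiffOn ℝ ∞ (chartOne s) (univ ×ˢ actionDomain s) :=
  (contDiffOn_orbit s).comp (contDiffOn_angleActionInv hs)
    fun _ hz => ⟨mem_univ _, angleActionInv_mem hz.2⟩

theorem energyOne_chartOne_mem {s : ℝ} (hs : s * s = 1) {z : ℝ × ℝ} (hz : z.2 ∈ actionDomain s) :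
    energyOne (chartOne s z) ∈ Ioo (-2 : ℝ) 0 := by
  have hm := angleActionInv_mem hz
  rw [chartOne, energyOne_orbit hs hm]
  constructor <;> linarith [hm.1, hm.2]

theorem modulus_sq_chartOne {s : ℝ} (hs : s * s = 1) {z : ℝ × ℝ} (hz : z.2 ∈ actionDomain s) :
    modulus (energyOne (chartOne s z)) ^ 2 = (angleActionInv s z).2 := by
  rw [modulus_sq (energyOne_chartOne_mem hs hz), chartOne,
    energyOne_orbit hs (angleActionInv_mem hz)]
  ring

theorem action_chartOne {s : ℝ} (hs : s * s = 1) {z : ℝ × ℝ} (hz : z.2 ∈ actionDomain s) :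
    s * actionJ (energyOne (chartOne s z)) = z.2 := by
  rw [actionJ_eq (energyOne_chartOne_mem hs hz), modulus_sq_chartOne hs hz]
  exact congrArg Prod.snd (angleAction_angleActionInv hz)

theorem image_chartOne {s : ℝ} (hs : s * s = 1) :
    chartOne s '' (univ ×ˢ actionDomain s) = {y | energyOne y ∈ Ioo (-2 : ℝ) 0} := by
  ext y
  constructor
  · rintro ⟨z, hz, rfl⟩
    exact energyOne_chartOne_mem hs hz.2
  · intro hy
    obtain ⟨φ, m, hm, rfl⟩ := exists_orbit_eq hs hy
    refine ⟨angleAction s (φ, m), ?_, ?_⟩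
    · rw [← image_angleAction]
      exact mem_image_of_mem _ ⟨mem_univ _, hm⟩
    · rw [chartOne, angleActionInv_angleAction hs hm]

theorem actionJ_injOn : InjOn actionJ (Ioo (-2 : ℝ) 0) := by
  intro h hh h' hh' he
  rw [actionJ_eq hh, actionJ_eq hh'] at he
  have := strictAntiOn_areaAction.injOn (modulus_sq_mem hh) (modulus_sq_mem hh') he
  rw [modulus_sq hh, modulus_sq hh'] at this
  linarith

/-- Dividing time by `meanTime` makes a shift of φ by 2πn exactly a shift of the angle by 2πn. -/
theorem chartOne_eq_iff {s : ℝ} (hs : s * s = 1) {z w : ℝ × ℝ} (hz : z.2 ∈ actionDomain s)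
    (hw : w.2 ∈ actionDomain s) :
    chartOne s z = chartOne s w ↔ z.2 = w.2 ∧ ∃ n : ℤ, z.1 = w.1 + 2 * Real.pi * n := by
  have hmz := angleActionInv_mem hz
  have hmw := angleActionInv_mem hw
  have hAz := angleAction_angleActionInv hz
  have hAw := angleAction_angleActionInv hw
  rw [chartOne, chartOne, orbit_eq_iff hs hmz hmw]
  generalize angleActionInv s z = a at hmz hAz ⊢
  generalize angleActionInv s w = b at hmw hAw ⊢
  subst hAz hAw
  obtain ⟨φ, m⟩ := a
  obtain ⟨φ', m'⟩ := b
  simp only at hmz hmw ⊢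
  have hs0 : s ≠ 0 := left_ne_zero_of_mul_eq_one hs
  have h1 : s * areaAction m = s * areaAction m' ↔ m = m' :=
    ⟨fun h => strictAntiOn_areaAction.injOn hmz hmw (mul_left_cancel₀ hs0 h), fun h => h ▸ rfl⟩
  simp only [angleAction, h1]
  refine and_congr_right fun h => ?_
  subst h
  refine exists_congr fun n => ?_
  have hΩ := (meanTime_pos hmz).ne'
  have h2 : timeFunction φ m / meanTime m = timeFunction φ' m / meanTime m + 2 * Real.pi * n ↔
      timeFunction φ m = timeFunction (φ' + 2 * Real.pi * n) m := by
    rw [timeFunction_add_int_mul_two_pi hmz]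
    field_simp
  rw [h2, (strictMono_timeFunction hmz).injective.eq_iff]

theorem actionJ_mem_actionDomain (s : ℝ) {h : ℝ} (hh : h ∈ Ioo (-2 : ℝ) 0) :
    s * actionJ h ∈ actionDomain s := mem_image_of_mem _ hh

theorem energyOne_chartOne {s : ℝ} (hs : s * s = 1) {h : ℝ} (hh : h ∈ Ioo (-2 : ℝ) 0) (θ : ℝ) :
    energyOne (chartOne s (θ, s * actionJ h)) = h := by
  have hJ : (θ, s * actionJ h).2 ∈ actionDomain s := actionJ_mem_actionDomain s hh
  exact actionJ_injOn (energyOne_chartOne_mem hs hJ) hh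
    (mul_left_cancel₀ (left_ne_zero_of_mul_eq_one hs) (action_chartOne hs hJ))

theorem returnOmega_pos {h : ℝ} (hh : h ∈ Ioo (-2 : ℝ) 0) : 0 < returnOmega h :=
  returnOmega_eq hh ▸ meanTime_pos (modulus_sq_mem hh)

/-- The derivative of the action is minus the period divided by `2π`. -/
theorem hasDerivAt_actionJ {h : ℝ} (hh : h ∈ Ioo (-2 : ℝ) 0) :
    HasDerivAt actionJ (-returnOmega h) h := by
  have h1 : HasDerivAt (fun h : ℝ => (2 + h) / 4) (1 / 4) h :=
    ((hasDerivAt_id h).const_add 2).div_const 4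
  have hm := modulus_sq_mem hh
  have h2 := hasDerivAt_areaAction hm
  have hr := returnOmega_eq hh
  rw [modulus_sq hh] at h2 hr
  refine ((h2.comp h h1).congr_deriv (by rw [hr]; ring)).congr_of_eventuallyEq ?_
  filter_upwards [isOpen_Ioo.mem_nhds hh] with y hy
  rw [actionJ_eq hy, modulus_sq hy, Function.comp_apply]

/-- The parameter `φ` as a function of the angle. -/
theorem exists_angle_parametrization {s : ℝ} (hs : s * s = 1) {h : ℝ}
    (hh : h ∈ Ioo (-2 : ℝ) 0) :
    ∃ φ : ℝ → ℝ, (∀ θ, chartOne s (θ, s * actionJ h) = orbit s (φ θ) (modulus h ^ 2)) ∧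
      (∀ θ, HasDerivAt φ (returnOmega h / timeDensity (φ θ) (modulus h ^ 2)) θ) ∧
      ∀ θ, φ (θ + 2 * Real.pi) = φ θ + 2 * Real.pi := by
  have hJ : ∀ θ : ℝ, (θ, s * actionJ h).2 ∈ actionDomain s :=
    fun _ => actionJ_mem_actionDomain s hh
  have hm := modulus_sq_mem hh
  have hsnd : ∀ θ, (angleActionInv s (θ, s * actionJ h)).2 = modulus h ^ 2 := fun θ => by
    rw [← modulus_sq_chartOne hs (hJ θ), energyOne_chartOne hs hh]
  have hfst : ∀ θ, timeFunction (angleActionInv s (θ, s * actionJ h)).1 (modulus h ^ 2)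
      / returnOmega h = θ := fun θ => by
    have := congrArg Prod.fst (angleAction_angleActionInv (hJ θ))
    rwa [angleAction, hsnd, ← returnOmega_eq hh] at this
  have hΩ := (returnOmega_pos hh).ne'
  refine ⟨fun θ => (angleActionInv s (θ, s * actionJ h)).1, fun θ => by rw [chartOne, hsnd],
    fun θ => ?_, fun θ => (strictMono_timeFunction hm).injective ?_⟩
  · have hc : Continuous fun θ => (angleActionInv s (θ, s * actionJ h)).1 :=
      continuous_fst.comp ((contDiffOn_angleActionInv hs).continuousOn.comp_continuous
        (f := fun θ : ℝ => (θ, s * actionJ h)) (by fun_prop) fun θ => ⟨mem_univ _, hJ θ⟩)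
    -- For fixed action, φ is a continuous inverse of normalized time, so its derivative is the
    -- reciprocal one.
    refine (HasDerivAt.of_local_left_inverse (f := fun φ =>
      timeFunction φ (modulus h ^ 2) / returnOmega h) hc.continuousAt
      ((hasDerivAt_timeFunction hm _).div_const _)
      (div_ne_zero (timeDensity_pos hm _).ne' hΩ)
      (Eventually.of_forall hfst)).congr_deriv (inv_div _ _)
  · have h1 := hfst θ
    have h2 := hfst (θ + 2 * Real.pi)
    simp only
    rw [timeFunction_add_two_pi hm, ← returnOmega_eq hh]
    rw [div_eq_iff hΩ] at h1 h2
    rw [h1, h2]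
    ring

theorem hasDerivAt_chartOne {s : ℝ} (hs : s * s = 1) {h : ℝ} (hh : h ∈ Ioo (-2 : ℝ) 0) (θ : ℝ) :
    HasDerivAt (fun θ => chartOne s (θ, s * actionJ h))
      (returnOmega h • sitnikovField s (chartOne s (θ, s * actionJ h))) θ := by
  obtain ⟨φ, h1, h2, -⟩ := exists_angle_parametrization hs hh
  have hm := modulus_sq_mem hh
  simp only [h1]
  refine ((hasDerivAt_orbit hs hm (φ θ)).scomp θ (h2 θ)).congr_deriv ?_
  rw [smul_smul, div_mul_cancel₀ _ (timeDensity_pos hm _).ne']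

/-- The integrand is p dq/dθ, since dq/dθ = Ω · (-s p). Substituting φ for θ turns it into -s times
the integrand of `areaAction`, taken over a full period. -/
theorem integral_chartOne {s : ℝ} (hs : s * s = 1) {h : ℝ} (hh : h ∈ Ioo (-2 : ℝ) 0) (θ₀ : ℝ) :
    ∫ θ in θ₀..(θ₀ + 2 * Real.pi), (chartOne s (θ, s * actionJ h)).2 *
        (returnOmega h * -(s * (chartOne s (θ, s * actionJ h)).2))
      = 2 * Real.pi * (s * actionJ h) := by
  obtain ⟨φ, h1, h2, h3⟩ := exists_angle_parametrization hs hh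
  have hm := modulus_sq_mem hh
  have hw := continuous_timeDensity hm
  have hφ : Continuous φ := continuous_iff_continuousAt.2 fun θ => (h2 θ).continuousAt
  have h22 : Real.sqrt 2 ^ 2 = 2 := Real.sq_sqrt (by norm_num)
  have hmm : Real.sqrt (modulus h ^ 2) ^ 2 = modulus h ^ 2 := Real.sq_sqrt hm.1.le
  set g : ℝ → ℝ := fun φ => 8 * modulus h ^ 2 * Real.cos φ ^ 2 * timeDensity φ (modulus h ^ 2)
    with hg
  have hgc : Continuous g := by fun_prop
  have hper : Function.Periodic g (2 * Real.pi) := fun φ => by simp [hg, timeDensity]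
  have key : ∀ θ, (chartOne s (θ, s * actionJ h)).2 *
      (returnOmega h * -(s * (chartOne s (θ, s * actionJ h)).2))
      = -s * ((g ∘ φ) θ * (returnOmega h / timeDensity (φ θ) (modulus h ^ 2))) := fun θ => by
    have hw0 := (timeDensity_pos hm (φ θ)).ne'
    rw [h1, Function.comp_apply]
    simp only [orbit, hg]
    generalize Real.sqrt (modulus h ^ 2) = r at *
    rw [mul_assoc (8 * modulus h ^ 2 * _), mul_div_cancel₀ _ hw0, ← hmm]
    linear_combination -4 * s * r ^ 2 * Real.cos (φ θ) ^ 2 * returnOmega h * (s ^ 2 * h22 + 2 * hs)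
  simp only [key]
  rw [intervalIntegral.integral_const_mul, intervalIntegral.integral_comp_mul_deriv
    (fun θ _ => h2 θ) (continuous_const.div (hw.comp hφ)
      fun θ => (timeDensity_pos hm _).ne').continuousOn hgc, h3, hper.intervalIntegral_add_eq _ 0,
    zero_add, actionJ_eq hh, areaAction]
  have hpi := Real.pi_pos.ne'
  field_simp
  rfl

theorem chartOne_solution {s : ℝ} (hs : s * s = 1) {h : ℝ} (hh : h ∈ Ioo (-2 : ℝ) 0) (θ₀ t : ℝ) :
    HasDerivAt (fun t => chartOne s (1 / returnOmega h * t + θ₀, s * actionJ h))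
      (sitnikovField s (chartOne s (1 / returnOmega h * t + θ₀, s * actionJ h))) t := by
  have h1 : HasDerivAt (fun t => 1 / returnOmega h * t + θ₀) (1 / returnOmega h) t := by
    simpa using ((hasDerivAt_id t).const_mul (1 / returnOmega h)).add_const θ₀
  refine ((hasDerivAt_chartOne hs hh _).scomp t h1).congr_deriv ?_
  rw [smul_smul, one_div_mul_cancel (returnOmega_pos hh).ne', one_smul]

/-- The initial point lies in the image of the chart; its angle there is θ₀, and uniqueness
identifies the two solutions. -/
theorem solution_eq_chartOne {s : ℝ} (hs : s * s = 1) {x : ℝ → ℝ × ℝ}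
    (hx : ∀ t, HasDerivAt x (sitnikovField s (x t)) t) (h0 : energyOne (x 0) ∈ Ioo (-2 : ℝ) 0) :
    ∃ θ₀, ∀ t, x t = chartOne s (1 / returnOmega (energyOne (x 0)) * t + θ₀,
      s * actionJ (energyOne (x 0))) := by
  have h1 : x 0 ∈ chartOne s '' (univ ×ˢ actionDomain s) := (image_chartOne hs).symm ▸ h0
  obtain ⟨⟨θ₀, J⟩, ⟨-, hJ⟩, hz⟩ := h1
  have hJe := action_chartOne (z := (θ₀, J)) hs hJ
  rw [hz] at hJe
  refine ⟨θ₀, fun t => ?_⟩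
  refine congrFun (sitnikovField_solution_unique hx (fun t => chartOne_solution hs h0 θ₀ t) ?_) t
  simp only [mul_zero, zero_add]
  rw [hJe]
  exact hz.symm

/-- In the plane it suffices to pair ∂/∂θ with ∂/∂J. The former is Ω times the Hamiltonian field, so
the pairing is -sΩ times the J-derivative of the energy. -/
theorem chartOne_symplectic {s : ℝ} (hs : s * s = 1) {z : ℝ × ℝ} (hz : z.2 ∈ actionDomain s)
    (v w : ℝ × ℝ) :
    (fderiv ℝ (chartOne s) z v).2 * (fderiv ℝ (chartOne s) z w).1
      - (fderiv ℝ (chartOne s) z w).2 * (fderiv ℝ (chartOne s) z v).1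
      = v.2 * w.1 - w.2 * v.1 := by
  obtain ⟨θ, J⟩ := z
  obtain ⟨h, hh, rfl⟩ := hz
  simp only
  have hO := (isOpen_univ (X := ℝ)).prod (isOpen_actionDomain hs)
  have hmem : (θ, s * actionJ h) ∈ univ ×ˢ actionDomain s :=
    ⟨mem_univ _, actionJ_mem_actionDomain s hh⟩
  have hd : HasFDerivAt (chartOne s) (fderiv ℝ (chartOne s) (θ, s * actionJ h))
      (θ, s * actionJ h) :=
    (((contDiffOn_chartOne hs).contDiffAt (hO.mem_nhds hmem)).differentiableAt
      (by simp)).hasFDerivAt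
  set L := fderiv ℝ (chartOne s) (θ, s * actionJ h)
  set y := chartOne s (θ, s * actionJ h) with hy
  have ha : L (1, 0) = returnOmega h • sitnikovField s y :=
    (HasFDerivAt.comp_hasDerivAt (l := chartOne s) (f := fun θ => (θ, s * actionJ h)) θ hd
      ((hasDerivAt_id θ).prodMk (hasDerivAt_const θ (s * actionJ h)))).unique
      (hasDerivAt_chartOne hs hh θ)
  -- This is the J-derivative of the identity s J(h) = J, with dJ/dh = -Ω.
  have hb : s * (-returnOmega h * (y.2 * (L (0, 1)).2 + energySlope y.1 * (L (0, 1)).1)) = 1 := by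
    have hJ := hasDerivAt_actionJ hh
    have he : energyOne y = h := energyOne_chartOne hs hh θ
    rw [← he] at hJ
    have h0 : HasFDerivAt (energyOne ∘ chartOne s) _ (θ, s * actionJ h) :=
      (hasFDerivAt_energyOne y).comp (θ, s * actionJ h) hd
    have h1 := (HasDerivAt.comp_hasFDerivAt (θ, s * actionJ h) hJ h0).const_mul s
    have h2 : HasFDerivAt (fun z : ℝ × ℝ => s * actionJ (energyOne (chartOne s z)))
        (ContinuousLinearMap.snd ℝ ℝ ℝ) (θ, s * actionJ h) := by
      refine hasFDerivAt_snd.congr_of_eventuallyEq ?_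
      filter_upwards [hO.mem_nhds hmem] with z hz
      exact action_chartOne hs hz.2
    have h3 := DFunLike.congr_fun (h1.unique h2) (0, 1)
    simpa [he, mul_add, add_comm] using h3
  have hv : ∀ v : ℝ × ℝ, L v = v.1 • L (1, 0) + v.2 • L (0, 1) := fun v => by
    rw [← map_smul, ← map_smul, ← map_add]
    simp
  rw [hv v, hv w, ha]
  generalize L (0, 1) = b at *
  simp only [sitnikovField, Prod.fst_add, Prod.snd_add, Prod.smul_fst, Prod.smul_snd, smul_eq_mul]
  linear_combination (v.2 * w.1 - w.2 * v.1) * hb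

end

/-! ### The action of a single secondary along a solution -/

noncomputable section

theorem hasDerivAt_fst_of_prod {f : ℝ → ℝ × ℝ} {f' : ℝ × ℝ} {t : ℝ} (h : HasDerivAt f f' t) :
    HasDerivAt (fun t => (f t).1) f'.1 t :=
  (ContinuousLinearMap.fst ℝ ℝ ℝ).hasFDerivAt.comp_hasDerivAt t h

theorem hasDerivAt_snd_of_prod {f : ℝ → ℝ × ℝ} {f' : ℝ × ℝ} {t : ℝ} (h : HasDerivAt f f' t) :
    HasDerivAt (fun t => (f t).2) f'.2 t :=
  (ContinuousLinearMap.snd ℝ ℝ ℝ).hasFDerivAt.comp_hasDerivAt t h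

/-- By `chartOne_eq_iff` the motion returns after time T exactly when T/Ω is an integer multiple of
2π. -/
theorem isLeast_period_chartOne {s : ℝ} (hs : s * s = 1) {h : ℝ} (hh : h ∈ Ioo (-2 : ℝ) 0)
    (θ₀ : ℝ) :
    IsLeast {T : ℝ | 0 < T ∧ ∀ t,
      chartOne s (1 / returnOmega h * (t + T) + θ₀, s * actionJ h)
        = chartOne s (1 / returnOmega h * t + θ₀, s * actionJ h)}
      (2 * Real.pi * returnOmega h) := by
  have hΩ := returnOmega_pos hh
  have hJ := actionJ_mem_actionDomain s hh
  have hiff : ∀ t T, chartOne s (1 / returnOmega h * (t + T) + θ₀, s * actionJ h)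
      = chartOne s (1 / returnOmega h * t + θ₀, s * actionJ h)
      ↔ ∃ n : ℤ, T = 2 * Real.pi * returnOmega h * n := fun t T => by
    rw [chartOne_eq_iff hs hJ hJ]
    simp only [true_and]
    refine exists_congr fun n => ?_
    field_simp
    constructor <;> intro h <;> linarith
  refine ⟨⟨by have := Real.pi_pos; positivity, fun t => (hiff _ _).2 ⟨1, by simp⟩⟩, ?_⟩
  rintro T ⟨hT, hper⟩
  obtain ⟨n, rfl⟩ := (hiff _ _).1 (hper 0)
  have hP : 0 < 2 * Real.pi * returnOmega h := by have := Real.pi_pos; positivity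
  have hn : (0 : ℝ) < n := (mul_pos_iff_of_pos_left hP).1 hT
  have hn1 : (1 : ℝ) ≤ n := by exact_mod_cast (by exact_mod_cast hn : (0 : ℤ) < n)
  exact le_mul_of_one_le_right hP.le hn1

theorem integral_action_chartOne {s : ℝ} (hs : s * s = 1) {h : ℝ} (hh : h ∈ Ioo (-2 : ℝ) 0)
    (θ₀ : ℝ) :
    ∫ t in (0 : ℝ)..(2 * Real.pi * returnOmega h),
      (chartOne s (1 / returnOmega h * t + θ₀, s * actionJ h)).2 *
        deriv (fun t => (chartOne s (1 / returnOmega h * t + θ₀, s * actionJ h)).1) t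
      = 2 * Real.pi * (s * actionJ h) := by
  have hΩ := (returnOmega_pos hh).ne'
  have hd : ∀ t, deriv (fun t => (chartOne s (1 / returnOmega h * t + θ₀, s * actionJ h)).1) t
      = -(s * (chartOne s (1 / returnOmega h * t + θ₀, s * actionJ h)).2) := fun t =>
    (hasDerivAt_fst_of_prod (chartOne_solution hs hh θ₀ t)).deriv
  rw [← integral_chartOne hs hh θ₀]
  have h1 := intervalIntegral.mul_integral_comp_mul_add (a := 0) (b := 2 * Real.pi * returnOmega h)
    (f := fun θ => (chartOne s (θ, s * actionJ h)).2 *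
        (returnOmega h * -(s * (chartOne s (θ, s * actionJ h)).2)))
    (c := 1 / returnOmega h) (d := θ₀)
  rw [mul_zero, zero_add, show 1 / returnOmega h * (2 * Real.pi * returnOmega h) + θ₀
      = θ₀ + 2 * Real.pi by field_simp; ring,
    ← intervalIntegral.integral_const_mul] at h1
  rw [← h1]
  refine intervalIntegral.integral_congr fun t _ => ?_
  simp only [hd]
  field_simp

/-! ### The double Sitnikov problem as a product -/

/-- Position and momentum of the secondary `i`. -/
def coordinatePair (i : Fin 2) : Phase →L[ℝ] ℝ × ℝ :=
  ((ContinuousLinearMap.proj i).comp (ContinuousLinearMap.fst ℝ (Fin 2 → ℝ) (Fin 2 → ℝ))).prod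
    ((ContinuousLinearMap.proj i).comp (ContinuousLinearMap.snd ℝ (Fin 2 → ℝ) (Fin 2 → ℝ)))

@[simp]
theorem coordinatePair_apply (i : Fin 2) (x : Phase) : coordinatePair i x = (x.1 i, x.2 i) := rfl

theorem coordinatePair_ext {x y : Phase} (h : ∀ i, coordinatePair i x = coordinatePair i y) :
    x = y :=
  Prod.ext (funext fun i => congrArg Prod.fst (h i)) (funext fun i => congrArg Prod.snd (h i))

theorem fderiv_hamiltonian (x w : Phase) :
    fderiv ℝ hamiltonian x w = ∑ i, (x.2 i * w.2 i + energySlope (x.1 i) * w.1 i) := by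
  have h : hamiltonian = fun x => ∑ i, energyOne (coordinatePair i x) := by
    funext x
    simp only [hamiltonian, energyOne, Fin.sum_univ_two, coordinatePair_apply]
    ring
  have h1 : HasFDerivAt (fun x => ∑ i, energyOne (coordinatePair i x)) _ x :=
    HasFDerivAt.fun_sum (u := Finset.univ) fun i _ =>
      (hasFDerivAt_energyOne (coordinatePair i x)).comp x (coordinatePair i).hasFDerivAt
  rw [h, h1.fderiv]
  simp

theorem isHamiltonianCurve_iff {s : ℝ} {x : ℝ → Phase} :
    IsHamiltonianCurve s hamiltonian x ↔
      ∀ i t, HasDerivAt (fun t => ((x t).1 i, (x t).2 i))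
        (sitnikovField s ((x t).1 i, (x t).2 i)) t := by
  constructor
  · intro hx i t
    obtain ⟨v, hv, hw⟩ := hx t
    refine ((coordinatePair i).hasFDerivAt.comp_hasDerivAt t hv).congr_deriv ?_
    -- Testing against the i-th position and momentum directions extracts the two Hamilton equations
    -- of that secondary.
    have h1 := hw (Pi.single i 1, 0)
    have h2 := hw (0, Pi.single i 1)
    rw [fderiv_hamiltonian] at h1 h2
    simp [omega, Pi.single_apply] at h1 h2
    simp only [sitnikovField, coordinatePair_apply, Prod.mk.injEq]
    exact ⟨by linarith, h1⟩
  · intro hx t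
    refine ⟨(fun i => -(s * (x t).2 i), fun i => s * energySlope ((x t).1 i)), ?_, fun w => ?_⟩
    · exact (hasDerivAt_pi.2 fun i => hasDerivAt_fst_of_prod (hx i t)).prodMk
        (hasDerivAt_pi.2 fun i => hasDerivAt_snd_of_prod (hx i t))
    · rw [fderiv_hamiltonian, omega, Finset.mul_sum]
      exact Finset.sum_congr rfl fun i _ => by ring

/-- Action-angle coordinates for both secondaries. -/
def chart (s : ℝ) (z : Phase) : Phase :=
  (fun i => (chartOne s (z.1 i, z.2 i)).1, fun i => (chartOne s (z.1 i, z.2 i)).2)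

theorem coordinatePair_chart (s : ℝ) (z : Phase) (i : Fin 2) :
    coordinatePair i (chart s z) = chartOne s (coordinatePair i z) := rfl

theorem contDiffOn_chart {s : ℝ} (hs : s * s = 1) :
    ContDiffOn ℝ ∞ (chart s) (univ ×ˢ {J | ∀ i, J i ∈ actionDomain s}) := by
  have h : ∀ i, ContDiffOn ℝ ∞ (fun z : Phase => chartOne s (z.1 i, z.2 i))
      (univ ×ˢ {J | ∀ i, J i ∈ actionDomain s}) := fun i =>
    (contDiffOn_chartOne hs).comp (coordinatePair i).contDiff.contDiffOn
      fun z hz => ⟨mem_univ _, hz.2 i⟩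
  exact (contDiffOn_pi.2 fun i => (h i).fst).prodMk (contDiffOn_pi.2 fun i => (h i).snd)

theorem isOpen_actions {s : ℝ} (hs : s * s = 1) :
    IsOpen {J : Fin 2 → ℝ | ∀ i, J i ∈ actionDomain s} := by
  rw [ofPred_forall]
  exact isOpen_iInter_of_finite fun i => (isOpen_actionDomain hs).preimage (continuous_apply i)

theorem coordinatePair_fderiv_chart {s : ℝ} (hs : s * s = 1) {z : Phase}
    (hz : ∀ i, z.2 i ∈ actionDomain s) (i : Fin 2) (v : Phase) :
    coordinatePair i (fderiv ℝ (chart s) z v)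
      = fderiv ℝ (chartOne s) (coordinatePair i z) (coordinatePair i v) := by
  have h1 : HasFDerivAt (chart s) (fderiv ℝ (chart s) z) z :=
    (((contDiffOn_chart hs).contDiffAt ((isOpen_univ.prod (isOpen_actions hs)).mem_nhds
      ⟨mem_univ _, hz⟩)).differentiableAt (by simp)).hasFDerivAt
  have h2 : HasFDerivAt (chartOne s) (fderiv ℝ (chartOne s) (coordinatePair i z))
      (coordinatePair i z) :=
    (((contDiffOn_chartOne hs).contDiffAt ((isOpen_univ.prod (isOpen_actionDomain hs)).mem_nhds
      ⟨mem_univ _, hz i⟩)).differentiableAt (by simp)).hasFDerivAt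
  exact DFunLike.congr_fun (((coordinatePair i).hasFDerivAt.comp z h1).unique
    (h2.comp z (coordinatePair i).hasFDerivAt)) v

theorem action_eq_chart {s : ℝ} (hs : s * s = 1) {z : Phase}
    (hz : ∀ i, z.2 i ∈ actionDomain s) (i : Fin 2) :
    z.2 i = 1 / (2 * Real.pi) * ∫ φ in (0 : ℝ)..(2 * Real.pi),
      ∑ j, (chart s (Function.update z.1 i φ, z.2)).2 j *
        deriv (fun ψ : ℝ => (chart s (Function.update z.1 i ψ, z.2)).1 j) φ := by
  obtain ⟨h, hh, hJ⟩ := hz i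
  simp only at hJ
  have key : ∀ φ, ∑ j, (chart s (Function.update z.1 i φ, z.2)).2 j *
      deriv (fun ψ : ℝ => (chart s (Function.update z.1 i ψ, z.2)).1 j) φ
      = (chartOne s (φ, s * actionJ h)).2 *
        (returnOmega h * -(s * (chartOne s (φ, s * actionJ h)).2)) := fun φ => by
    rw [Finset.sum_eq_single i]
    · simp only [chart, Function.update_self, ← hJ]
      rw [(hasDerivAt_fst_of_prod (hasDerivAt_chartOne hs hh φ)).deriv]
      rfl
    -- The position of the other secondary does not depend on the angle that varies, so its term in
    -- p dq vanishes.
    · intro j _ hj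
      simp [chart, Function.update_of_ne hj]
    · simp
  have h0 := integral_chartOne hs hh 0
  rw [zero_add] at h0
  simp only [key]
  rw [h0, ← hJ]
  have := Real.pi_pos.ne'
  field_simp

theorem isActionAngleChart_chart {s : ℝ} (hs : s * s = 1) :
    IsActionAngleChart hamiltonian oscillationRegion {J | ∀ i, J i ∈ actionDomain s}
      (chart s) where
  isOpen_actions := isOpen_actions hs
  smooth := contDiffOn_chart hs
  image_eq := by
    ext x
    constructor
    · rintro ⟨z, ⟨-, hz⟩, rfl⟩ i
      exact energyOne_chartOne_mem hs (z := coordinatePair i z) (hz i)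
    · intro hx
      have h : ∀ i, ∃ z : ℝ × ℝ, z.2 ∈ actionDomain s ∧ chartOne s z = coordinatePair i x := by
        intro i
        have h1 : coordinatePair i x ∈ chartOne s '' (univ ×ˢ actionDomain s) :=
          (image_chartOne hs).symm ▸ hx i
        obtain ⟨z, hz, h2⟩ := h1
        exact ⟨z, hz.2, h2⟩
      choose z hz1 hz2 using h
      exact ⟨(fun i => (z i).1, fun i => (z i).2), ⟨mem_univ _, hz1⟩, coordinatePair_ext hz2⟩
  eq_iff := by
    rintro z ⟨-, hz⟩ w ⟨-, hw⟩
    have h := fun i => chartOne_eq_iff hs (z := coordinatePair i z) (w := coordinatePair i w)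
      (hz i) (hw i)
    rw [funext_iff, ← forall_and]
    refine Iff.trans ?_ (forall_congr' h)
    exact ⟨fun e i => congrArg (coordinatePair i) e, fun e => coordinatePair_ext e⟩
  symplectic := by
    rintro z ⟨-, hz⟩ v w
    refine Finset.sum_congr rfl fun i _ => ?_
    have h := chartOne_symplectic hs (z := coordinatePair i z) (hz i) (coordinatePair i v)
      (coordinatePair i w)
    rwa [← coordinatePair_fderiv_chart hs hz, ← coordinatePair_fderiv_chart hs hz] at h
  energy := by
    rintro z ⟨-, hz⟩ w ⟨-, hw⟩ hzw
    -- Each partial energy is determined by its own action, because J is injective in the energy.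
    have h : ∀ i, energyOne (chartOne s (coordinatePair i z))
        = energyOne (chartOne s (coordinatePair i w)) := fun i => by
      refine actionJ_injOn (energyOne_chartOne_mem hs (z := coordinatePair i z) (hz i))
        (energyOne_chartOne_mem hs (z := coordinatePair i w) (hw i))
        (mul_left_cancel₀ (left_ne_zero_of_mul_eq_one hs) ?_)
      rw [action_chartOne hs (z := coordinatePair i z) (hz i),
        action_chartOne hs (z := coordinatePair i w) (hw i)]
      exact congrFun hzw i
    have h0 := h 0
    have h1 := h 1
    rw [← coordinatePair_chart, ← coordinatePair_chart] at h0 h1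
    simp only [energyOne, coordinatePair_apply] at h0 h1
    unfold hamiltonian
    linarith
  action_eq := fun _ hz i => action_eq_chart hs hz.2 i

end

end DoubleSitnikov

/-! ### The theorem for both secondaries -/

theorem mainTheorem2 (s : ℝ) (hs : s = 1 ∨ s = -1) :
    -- each oscillating secondary returns first after time `2πΩ`, and its action is `s J`
    (∀ x : ℝ → DoubleSitnikov.Phase,
      DoubleSitnikov.IsHamiltonianCurve s DoubleSitnikov.hamiltonian x →
      ∀ i : Fin 2, DoubleSitnikov.partialEnergy (x 0) i ∈ Set.Ioo (-2 : ℝ) 0 →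
        IsLeast {T : ℝ | 0 < T ∧ ∀ t, (x (t + T)).1 i = (x t).1 i ∧ (x (t + T)).2 i = (x t).2 i}
          (2 * Real.pi * DoubleSitnikov.returnOmega (DoubleSitnikov.partialEnergy (x 0) i)) ∧
        1 / (2 * Real.pi) * (∫ t in (0 : ℝ)..(2 * Real.pi *
            DoubleSitnikov.returnOmega (DoubleSitnikov.partialEnergy (x 0) i)),
            (x t).2 i * deriv (fun u => (x u).1 i) t) =
          s * DoubleSitnikov.actionJ (DoubleSitnikov.partialEnergy (x 0) i)) ∧
    -- action-angle coordinates with these actions, in which the angles are linear in time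
    ∃ Ψ : DoubleSitnikov.Phase → DoubleSitnikov.Phase,
      DoubleSitnikov.IsActionAngleChart DoubleSitnikov.hamiltonian
        DoubleSitnikov.oscillationRegion
        {J | ∀ i, J i ∈ (fun h => s * DoubleSitnikov.actionJ h) '' Set.Ioo (-2 : ℝ) 0} Ψ ∧
      (∀ θ J : Fin 2 → ℝ,
        (∀ i, J i ∈ (fun h => s * DoubleSitnikov.actionJ h) '' Set.Ioo (-2 : ℝ) 0) →
        ∀ i, J i = s * DoubleSitnikov.actionJ (DoubleSitnikov.partialEnergy (Ψ (θ, J)) i)) ∧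
      (∀ x : ℝ → DoubleSitnikov.Phase,
        DoubleSitnikov.IsHamiltonianCurve s DoubleSitnikov.hamiltonian x →
        x 0 ∈ DoubleSitnikov.oscillationRegion →
        ∃ θ₀ : Fin 2 → ℝ, ∀ t,
          x t = Ψ
            (fun i => 1 / DoubleSitnikov.returnOmega (DoubleSitnikov.partialEnergy (x 0) i) * t
                + θ₀ i,
              fun i => s * DoubleSitnikov.actionJ (DoubleSitnikov.partialEnergy (x 0) i))) ∧
      (∀ θ₀ h : Fin 2 → ℝ, (∀ i, h i ∈ Set.Ioo (-2 : ℝ) 0) →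
        DoubleSitnikov.IsHamiltonianCurve s DoubleSitnikov.hamiltonian
          (fun t => Ψ (fun i => 1 / DoubleSitnikov.returnOmega (h i) * t + θ₀ i,
            fun i => s * DoubleSitnikov.actionJ (h i)))) := by
  have hss : s * s = 1 := by rcases hs with rfl | rfl <;> norm_num
  refine ⟨fun x hx i hi => ?_, DoubleSitnikov.chart s,
    DoubleSitnikov.isActionAngleChart_chart hss, fun θ J hJ i => ?_, fun x hx h0 => ?_,
    fun θ₀ h hh => ?_⟩
  -- The secondary `i` solves its own equation, so the energy of the other one may be arbitrary
  -- here.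
  · obtain ⟨θ₀, hθ⟩ := DoubleSitnikov.solution_eq_chartOne hss
      (DoubleSitnikov.isHamiltonianCurve_iff.1 hx i) hi
    change ∀ t, _ = DoubleSitnikov.chartOne s (1 / DoubleSitnikov.returnOmega
      (DoubleSitnikov.partialEnergy (x 0) i) * t + θ₀,
      s * DoubleSitnikov.actionJ (DoubleSitnikov.partialEnergy (x 0) i)) at hθ
    have hleast := DoubleSitnikov.isLeast_period_chartOne hss hi θ₀
    have hint := DoubleSitnikov.integral_action_chartOne hss hi θ₀
    simp only [← hθ] at hleast hint
    simp only [Prod.mk.injEq] at hleast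
    refine ⟨hleast, ?_⟩
    rw [hint]
    have := Real.pi_pos.ne'
    field_simp
  · exact (DoubleSitnikov.action_chartOne hss (z := (θ i, J i)) (hJ i)).symm
  · choose θ₀ hθ using fun i => DoubleSitnikov.solution_eq_chartOne hss
      (DoubleSitnikov.isHamiltonianCurve_iff.1 hx i) (h0 i)
    exact ⟨θ₀, fun t => DoubleSitnikov.coordinatePair_ext fun i => hθ i t⟩
  · exact DoubleSitnikov.isHamiltonianCurve_iff.2 fun i t =>
      DoubleSitnikov.chartOne_solution hss (hh i) (θ₀ i) t
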